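/- A Banach lattice on $\mathbb Z$ is a Banach space $E$ of complex sequences $f=\{f_j\}_{j\in\mathbb Z}$ such that $f\in E$ and $|g_j|\le |f_j|$ for all $j$ imply $g\in E$ and $\|g\|_E\le\|f\|_E$. Its norm is order continuous if $\|f_n\|_E\to 0$ for every sequence $f_n\in E$ with $\sup_n|f_n|\in E$ and $f_n\to 0$ pointwise. Its order dual $E'$ consists of all sequences $g$ such that $\|g\|_{E'}=\sup\{\sum_j|f_jg_j| : f\in E,\ \|f\|_E\le 1\}$ is finite. Let $\mathbb D$ be the open unit disk of $\mathbb C$; $H^\infty(E)$ (and likewise $H^\infty(E')$) is the space of functions $f=\{f_j\}:\mathbb D\to E$ with all $f_j$ analytic and $\|f\|_{H^\infty(E)}=\sup_{z\in\mathbb D}\|f(z)\|_E<\infty$. We say that $E$ has the corona property with constants $C_\delta$, $0<\delta<1$, if for every $0<\delta<1$ and every $f\in H^\infty(E)$ such that $\delta\le\|f(z)\|_E\le 1$ for all $z\in\mathbb D$ there is some $g\in H^\infty(E')$ with $\|g\|_{H^\infty(E')}\le C_\delta$ and $\sum_j f_j(z)g_j(z)=1$ for all $z\in\mathbb D$. Theorem.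 Let $E_0$, $E_1$ be Banach lattices on $\mathbb Z$ such that the space of pointwise products $E=E_0E_1=\{h_0h_1 : h_0\in E_0,\ h_1\in E_1\}$ with $\|h\|_E=\inf\{\|h_0\|_{E_0}\|h_1\|_{E_1} : h=h_0h_1,\ h_0\in E_0,\ h_1\in E_1\}$ is also a Banach lattice and has order continuous norm. If $E_0$ has the corona property with constants $C_\delta$, $0<\delta<1$, then $E$ has the corona property with constants $C_{\delta/2}$, $0<\delta<1$. -/

import Mathlib

open Filter Topology
open scoped ENNReal NNReal

namespace SeqLattice

/-- A space `E` of complex sequences on `ℤ` is encoded by its norm, extended by the value `∞` to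
the sequences that do not belong to `E`; thus `E = {f | ρ f < ∞}`.
`IsNormedLattice ρ` says that `E` is a normed lattice (a normed ideal space) on `ℤ`. -/
structure IsNormedLattice (ρ : (ℤ → ℂ) → ℝ≥0∞) : Prop where
  eq_zero_iff : ∀ f : ℤ → ℂ, ρ f = 0 ↔ f = 0
  smul : ∀ (c : ℂ) (f : ℤ → ℂ), ρ (c • f) = ‖c‖ₑ * ρ f
  add_le : ∀ f g : ℤ → ℂ, ρ (f + g) ≤ ρ f + ρ g
  mono : ∀ f g : ℤ → ℂ, (∀ j, ‖g j‖ ≤ ‖f j‖) → ρ g ≤ ρ f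

/-- A Banach lattice on `ℤ`: a normed lattice in which every Cauchy sequence converges. -/
structure IsBanachLattice (ρ : (ℤ → ℂ) → ℝ≥0∞) : Prop extends IsNormedLattice ρ where
  complete : ∀ u : ℕ → ℤ → ℂ, (∀ n, ρ (u n) < ∞) →
    (∀ ε : ℝ≥0∞, 0 < ε → ∃ N : ℕ, ∀ m ≥ N, ∀ n ≥ N, ρ (u m - u n) < ε) →
    ∃ f : ℤ → ℂ, ρ f < ∞ ∧ Tendsto (fun n => ρ (u n - f)) atTop (𝓝 0)

/-- Order continuity of the norm: if `f n → 0` pointwise and the `|f n|` have a common majorant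
in `E` (for an ideal space this is the same as `sup_n |f n| ∈ E`), then `‖f n‖ → 0`. -/
def OrderContinuous (ρ : (ℤ → ℂ) → ℝ≥0∞) : Prop :=
  ∀ (f : ℕ → ℤ → ℂ) (F : ℤ → ℂ), ρ F < ∞ → (∀ n j, ‖f n j‖ ≤ ‖F j‖) →
    (∀ j, Tendsto (fun n => f n j) atTop (𝓝 0)) →
    Tendsto (fun n => ρ (f n)) atTop (𝓝 0)

/-- The quasi-norm of the pointwise product `E₀ E₁ = {h₀ h₁ | h₀ ∈ E₀, h₁ ∈ E₁}`; it is `∞`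
exactly when there is no such factorization. -/
noncomputable def prodNorm (ρ₀ ρ₁ : (ℤ → ℂ) → ℝ≥0∞) (h : ℤ → ℂ) : ℝ≥0∞ :=
  ⨅ (h₀ : ℤ → ℂ) (h₁ : ℤ → ℂ) (_ : ρ₀ h₀ < ∞) (_ : ρ₁ h₁ < ∞) (_ : h = h₀ * h₁), ρ₀ h₀ * ρ₁ h₁

/-- The norm of the order dual `E'`: the supremum of `∑ |f_j g_j|` over the unit ball of `E`. -/
noncomputable def dualNorm (ρ : (ℤ → ℂ) → ℝ≥0∞) (g : ℤ → ℂ) : ℝ≥0∞ :=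
  ⨆ (f : ℤ → ℂ) (_ : ρ f ≤ 1), ∑' j, ‖f j * g j‖ₑ

/-- The norm of `H^∞(E)`: the supremum of `‖f z‖_E` over the open unit disk. -/
noncomputable def hInftyNorm (ρ : (ℤ → ℂ) → ℝ≥0∞) (f : ℂ → ℤ → ℂ) : ℝ≥0∞ :=
  ⨆ z ∈ Metric.ball (0 : ℂ) 1, ρ (f z)

/-- `f = {f_j}` belongs to `H^∞(E)`: every `f_j` is analytic in the open unit disk, and `f` takes
values in `E` with bounded norms. (For a bounded function with values in a Banach lattice,
analyticity of all coordinates is the same as analyticity in norm, since the coordinate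
functionals are continuous and separate points.) -/
def MemHInfty (ρ : (ℤ → ℂ) → ℝ≥0∞) (f : ℂ → ℤ → ℂ) : Prop :=
  (∀ j, DifferentiableOn ℂ (fun z => f z j) (Metric.ball 0 1)) ∧ hInftyNorm ρ f < ∞

/-- The corona property with constants `C δ`, `0 < δ < 1` (values of `C` elsewhere are ignored). -/
def HasCoronaProperty (ρ : (ℤ → ℂ) → ℝ≥0∞) (C : ℝ → ℝ≥0) : Prop :=
  ∀ δ : ℝ, 0 < δ → δ < 1 → ∀ f : ℂ → ℤ → ℂ, MemHInfty ρ f →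
    (∀ z ∈ Metric.ball (0 : ℂ) 1, ENNReal.ofReal δ ≤ ρ (f z) ∧ ρ (f z) ≤ 1) →
    ∃ g : ℂ → ℤ → ℂ, MemHInfty (dualNorm ρ) g ∧ hInftyNorm (dualNorm ρ) g ≤ C δ ∧
      ∀ z ∈ Metric.ball (0 : ℂ) 1, HasSum (fun j => f z j * g z j) 1

end SeqLattice

namespace SeqLattice

/-! Consider first finitely many coordinates, with lattice norms `N₀`, `N₁` and product norm `N`.
Split the circle into small cells on which f is nearly constant. On each cell |f| factors through a
majorant a with `N₀ (|f| / a)` a little below 1 and `N₁ a` about 1. If ψ is the coordinatewise outer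
function with boundary modulus m ≥ a, then f/ψ has `N₀`-norm at most 1 on a slightly smaller disk,
and `N f ≤ N₀ (f/ψ) * N₁ ψ` bounds it from below. A corona solution G for f/ψ in the first lattice
gives the solution g = G/ψ for f.

The difficulty is to bound g in the dual of the product. Against one fixed weight h this can be
arranged: factor h = y w on each cell, with `N₁ w` about 1, and take m = max(a, |w|). Then |h g| =
|y| |G| |w| / |ψ| is essentially at most |y| |G| on the circle, so the pairing of h with |g| is at
most about C times the norm of h. Since `N₁ m ≤ N₁ a + N₁ w` is about 2, the lower bound for f/ψ is
half of that for f, and this is the origin of δ/2. The solution g still depends on h. The solutions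
form a convex set and the weights a compact convex set, so the minimax theorem
(`exists_forall_sum_mul_lt`, applied in `exists_solution_cell_averages_le`) yields one g that is
good for all weights. Testing with weights on a single cell bounds the cell averages of |g|, and
comparison with the Poisson kernel turns them into pointwise bounds inside the disk
(`sum_norm_le_of_cell_averages`). This is `exists_solution_of_hasFiniteCorona`.

The general case is reduced to this one by dilation and truncation. Order continuity and compactness
keep the truncated norms almost as large as δ on compact disks (`exists_truncate_forall_lt`). The
solutions on smaller disks, with constants decreasing to C(δ/2), have a coordinatewise limit, and
order continuity lets the identity ∑ f g = 1 survive the limit (`exists_solution_of_approximate`).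
-/

/-- A real lattice norm on `ι → ℝ`. -/
structure IsLatticeNorm {ι : Type*} (N : (ι → ℝ) → ℝ) : Prop where
  add_le : ∀ x y, N (x + y) ≤ N x + N y
  smul : ∀ (c : ℝ) x, N (c • x) = |c| * N x
  mono : ∀ x y, (∀ j, |x j| ≤ |y j|) → N x ≤ N y
  eq_zero : ∀ x, N x = 0 → x = 0

/-! ### Lattice norms: convexity, continuity, coordinate bounds. -/

namespace IsLatticeNorm

variable {ι : Type*} {N : (ι → ℝ) → ℝ}

lemma map_zero (h : IsLatticeNorm N) : N 0 = 0 := by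
  simpa using h.smul 0 0

lemma nonneg (h : IsLatticeNorm N) (x : ι → ℝ) : 0 ≤ N x := by
  rw [← h.map_zero]
  exact h.mono _ _ (by simp)

lemma abs_eq (h : IsLatticeNorm N) (x : ι → ℝ) : N (fun j => |x j|) = N x :=
  le_antisymm (h.mono _ _ (by simp)) (h.mono _ _ (by simp))

lemma smul_nonneg (h : IsLatticeNorm N) {c : ℝ} (hc : 0 ≤ c) (x : ι → ℝ) :
    N (c • x) = c * N x := by
  rw [h.smul, abs_of_nonneg hc]

lemma sum_le {κ : Type*} (h : IsLatticeNorm N) (s : Finset κ) (x : κ → ι → ℝ) :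
    N (∑ k ∈ s, x k) ≤ ∑ k ∈ s, N (x k) := by
  classical
  induction s using Finset.induction_on with
  | empty => simp [h.map_zero]
  | insert a s ha ih =>
    rw [Finset.sum_insert ha, Finset.sum_insert ha]
    exact (h.add_le _ _).trans (by gcongr)

lemma convexOn (h : IsLatticeNorm N) : ConvexOn ℝ Set.univ N := by
  refine ⟨convex_univ, fun x _ y _ a b ha hb _ => ?_⟩
  refine (h.add_le _ _).trans ?_
  rw [h.smul_nonneg ha, h.smul_nonneg hb]
  rfl

lemma continuous [Fintype ι] (h : IsLatticeNorm N) : Continuous N :=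
  h.convexOn.locallyLipschitz.continuous

lemma abs_mul_single_le [DecidableEq ι] (h : IsLatticeNorm N) (x : ι → ℝ) (j : ι) :
    |x j| * N (Pi.single j 1) ≤ N x := by
  rw [← h.smul]
  refine h.mono _ _ fun i => ?_
  by_cases hi : i = j
  · subst hi; simp
  · simp [hi]

lemma single_pos [DecidableEq ι] (h : IsLatticeNorm N) (j : ι) : 0 < N (Pi.single j 1) := by
  refine lt_of_le_of_ne (h.nonneg _) fun h0 => ?_
  have := congrFun (h.eq_zero _ h0.symm) j
  simp at this

/-- The norms of the unit vectors are positive and finite in number. The bound makes norm balls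
bounded and later controls the logarithms of majorants. -/
lemma exists_abs_le [Finite ι] (h : IsLatticeNorm N) :
    ∃ B : ℝ, 0 < B ∧ ∀ (x : ι → ℝ) (j : ι), |x j| ≤ B * N x := by
  classical
  have := Fintype.ofFinite ι
  refine ⟨1 + ∑ j, (N (Pi.single j 1))⁻¹, ?_, fun x j => ?_⟩
  · have : 0 ≤ ∑ j, (N (Pi.single j (1 : ℝ)))⁻¹ :=
      Finset.sum_nonneg fun j _ => inv_nonneg.2 (h.nonneg _)
    linarith
  · have h1 : (N (Pi.single j (1 : ℝ)))⁻¹ ≤ 1 + ∑ j, (N (Pi.single j (1 : ℝ)))⁻¹ := by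
      have := Finset.single_le_sum (f := fun j => (N (Pi.single j (1 : ℝ)))⁻¹)
        (fun j _ => inv_nonneg.2 (h.nonneg _)) (Finset.mem_univ j)
      linarith
    have h2 := h.abs_mul_single_le x j
    have h3 := h.single_pos j
    calc |x j| ≤ (N (Pi.single j (1 : ℝ)))⁻¹ * N x := by
          rw [inv_mul_eq_div, le_div_iff₀ h3]; exact h2
      _ ≤ _ := mul_le_mul_of_nonneg_right h1 (h.nonneg _)

/-- The closed unit ball of the complexification of a lattice norm is convex. -/
lemma convex_ball (h : IsLatticeNorm N) (c : ℝ) :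
    Convex ℝ {x : ι → ℂ | N (fun j => ‖x j‖) ≤ c} := by
  intro x hx y hy a b ha hb hab
  have : N (fun j => ‖(a • x + b • y) j‖) ≤ a * N (fun j => ‖x j‖) + b * N (fun j => ‖y j‖) := by
    rw [← h.smul_nonneg ha, ← h.smul_nonneg hb]
    refine le_trans (h.mono _ _ fun j => ?_) (h.add_le _ _)
    simp only [Pi.add_apply, Pi.smul_apply, smul_eq_mul, Complex.real_smul]
    rw [abs_of_nonneg (norm_nonneg _), abs_of_nonneg (by positivity)]
    refine (norm_add_le _ _).trans (le_of_eq ?_)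
    simp [abs_of_nonneg ha, abs_of_nonneg hb]
  calc _ ≤ _ := this
    _ ≤ a * c + b * c := add_le_add (mul_le_mul_of_nonneg_left hx ha)
        (mul_le_mul_of_nonneg_left hy hb)
    _ = c := by rw [← add_mul, hab, one_mul]

lemma isClosed_ball [Fintype ι] (h : IsLatticeNorm N) (c : ℝ) :
    IsClosed {x : ι → ℂ | N (fun j => ‖x j‖) ≤ c} :=
  isClosed_le (h.continuous.comp (by fun_prop)) continuous_const

end IsLatticeNorm

/-! ### Maximum principle and minimax for convex sets. -/

/-- The maximum principle with respect to a closed convex set. -/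
lemma mem_of_mem_sphere {ι : Type*} [Fintype ι] {K : Set (ι → ℂ)} (hK : Convex ℝ K)
    (hKc : IsClosed K) {φ : ℂ → ι → ℂ} {r : ℝ}
    (hφ : ∀ j, DiffContOnCl ℂ (fun z => φ z j) (Metric.ball 0 r))
    (hb : ∀ z ∈ Metric.sphere (0 : ℂ) r, φ z ∈ K) {z : ℂ} (hz : z ∈ Metric.ball (0 : ℂ) r) :
    φ z ∈ K := by
  by_contra hzK
  obtain ⟨l, u, hlu, hul⟩ := RCLike.geometric_hahn_banach_closed_point (𝕜 := ℂ) hK hKc hzK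
  have hd : DiffContOnCl ℂ (fun z => φ z) (Metric.ball 0 r) := by
    refine ⟨?_, ?_⟩
    · exact differentiableOn_pi.2 fun j => (hφ j).1
    · exact continuousOn_pi.2 fun j => (hφ j).2
  -- A separating functional only bounds a real part; exponentiation turns this into a bound on a
  -- modulus.
  have hd2 : DiffContOnCl ℂ (fun z => Complex.exp (l (φ z))) (Metric.ball 0 r) :=
    Complex.differentiable_exp.comp_diffContOnCl (l.differentiable.comp_diffContOnCl hd)
  have := Complex.norm_le_of_forall_mem_frontier_norm_le Metric.isBounded_ball hd2
    (C := Real.exp u) (fun w hw => by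
      rw [Complex.norm_exp]
      exact Real.exp_le_exp.2 (hlu _ (hb w (Metric.frontier_ball_subset_sphere hw))).le)
    (subset_closure hz)
  rw [Complex.norm_exp, Real.exp_le_exp] at this
  exact absurd hul (not_lt.2 this)

/-- The bilinear minimax theorem for a compact convex set `H` and a convex set `A`. -/
lemma exists_forall_sum_mul_lt {κ : Type*} [Fintype κ] {H A : Set (κ → ℝ)} (hHn : H.Nonempty)
    (hHc : IsCompact H) (hH : Convex ℝ H) (hA : Convex ℝ A) {c c' : ℝ} (hcc : c < c')
    (h : ∀ x ∈ H, ∃ a ∈ A, ∑ k, x k * a k ≤ c) :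
    ∃ a ∈ A, ∀ x ∈ H, ∑ k, x k * a k < c' := by
  -- The sign is reversed so that the compact set carries the minimising variable of Sion's theorem.
  set f : (κ → ℝ) → (κ → ℝ) → ℝ := fun x a => -∑ k, x k * a k with hf
  have hadd : ∀ x y a : κ → ℝ, ∀ s t : ℝ, f (s • x + t • y) a = s * f x a + t * f y a := by
    intro x y a s t
    simp only [hf, Pi.add_apply, Pi.smul_apply, smul_eq_mul, mul_neg, Finset.mul_sum, add_mul,
      Finset.sum_add_distrib, mul_assoc]
    ring
  have hadd' : ∀ x a b : κ → ℝ, ∀ s t : ℝ, f x (s • a + t • b) = s * f x a + t * f x b := by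
    intro x a b s t
    simp only [hf, Pi.add_apply, Pi.smul_apply, smul_eq_mul, mul_neg, Finset.mul_sum, mul_add,
      Finset.sum_add_distrib]
    simp only [mul_left_comm _ (x _) (_ : ℝ)]
    ring
  have hcl : ∀ a, Continuous fun x => f x a := fun a => by simp only [hf]; fun_prop
  have hcr : ∀ x, Continuous fun a => f x a := fun x => by simp only [hf]; fun_prop
  have hfy : ∀ y ∈ A, LowerSemicontinuousOn (fun x => f x y) H := fun y _ =>
    (hcl y).lowerSemicontinuous.lowerSemicontinuousOn _
  have hfy' : ∀ y ∈ A, QuasiconvexOn ℝ H fun x => f x y := fun y _ =>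
    ConvexOn.quasiconvexOn ⟨hH, fun x _ z _ s t _ _ _ => (hadd x z y s t).le⟩
  have hfx : ∀ x ∈ H, UpperSemicontinuousOn (fun y => f x y) A := fun x _ =>
    (hcr x).upperSemicontinuous.upperSemicontinuousOn _
  have hfx' : ∀ x ∈ H, QuasiconcaveOn ℝ A fun y => f x y := fun x _ =>
    ConcaveOn.quasiconcaveOn ⟨hA, fun a _ b _ s t _ _ _ => (hadd' x a b s t).ge⟩
  -- Compactness of `H` reduces to finitely many points of `A`, so `A` itself need not be compact or
  -- closed.
  have hcov : ∃ u : Finset A, ∀ x ∈ H, ∃ i ∈ u, -c' < f x i := by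
    rw [← LowerSemicontinuousOn.inter_biInter_preimage_Iic_eq_empty_iff_exists_finset
      (f := fun a x => f x a) hHc hfy]
    apply Set.eq_empty_of_forall_notMem
    rintro x ⟨hx, hx'⟩
    obtain ⟨a, ha, hac⟩ := h x hx
    have := Set.mem_iInter₂.1 hx' a ha
    simp only [Set.mem_preimage, Set.mem_Iic, hf] at this
    linarith
  obtain ⟨u, hu⟩ := hcov
  obtain ⟨a, ha, hau⟩ := Sion.exists_lt_iInf_of_lt_iInf_of_finite hHn hHc hfy hfy' hA hfx hfx' hH
    (t := -c') (Set.toFinite (Subtype.val '' (u : Set A))) (Subtype.coe_image_subset A _)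
    (fun x hx => by
      obtain ⟨i, hi, hi'⟩ := hu x hx
      exact ⟨i, by simp [hi], hi'⟩)
  refine ⟨a, ha, fun x hx => ?_⟩
  have := hau x hx
  simp only [hf] at this
  linarith

/-! ### Circle averages and partitions of the circle. -/

/-- The average over the unit circle. -/
noncomputable abbrev avg (X : ℂ → ℝ) : ℝ := Real.circleAverage X 0 1

/-- The indicator of the cell `{q = k}`. -/
def cellInd {κ : Type*} [DecidableEq κ] (q : ℂ → κ) (k : κ) (ξ : ℂ) : ℝ := if q ξ = k then 1 else 0

/-- `q` splits the unit circle into measurable cells of diameter at most `d`, and is locally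
constant off a countable set. -/
structure IsCirclePartition {κ : Type*} (q : ℂ → κ) (d : ℝ) : Prop where
  measurable : ∀ k, MeasurableSet (q ⁻¹' {k})
  diam : ∀ ξ ξ' : ℂ, ‖ξ‖ = 1 → ‖ξ'‖ = 1 → q ξ = q ξ' → ‖ξ - ξ'‖ ≤ d
  locally_const : ∃ F : Set ℂ, F.Countable ∧ ∀ ξ, ‖ξ‖ = 1 → ξ ∉ F → ∀ᶠ w in 𝓝 ξ, q w = q ξ

lemma norm_exp_I_sub_le (a b : ℝ) :
    ‖Complex.exp (a * Complex.I) - Complex.exp (b * Complex.I)‖ ≤ |a - b| := by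
  have h : Complex.exp (a * Complex.I) - Complex.exp (b * Complex.I) =
      Complex.exp (b * Complex.I) * (Complex.exp (Complex.I * ((a - b : ℝ) : ℂ)) - 1) := by
    rw [mul_sub, ← Complex.exp_add, mul_one]
    congr 2
    push_cast
    ring
  rw [h, norm_mul, Complex.norm_exp_ofReal_mul_I, one_mul]
  exact Real.norm_exp_I_mul_ofReal_sub_one_le

/-- The cells are the level sets of ⌊n arg⌋, that is, arcs of length at most 1/n. Since |arg| ≤ π ≤
4, the values lie between -4n and 4n. -/
lemma exists_circlePartition {n : ℕ} (hn : 0 < n) :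
    ∃ (κ : Type) (_ : Fintype κ) (q : ℂ → κ), IsCirclePartition q (1 / n) := by
  have hn' : (0 : ℝ) < n := by exact_mod_cast hn
  have hmem : ∀ w : ℂ, ⌊n * w.arg⌋ ∈ Finset.Icc (-(4 * n : ℤ)) (4 * n) := by
    intro w
    have h1 := Complex.neg_pi_lt_arg w
    have h2 := Complex.arg_le_pi w
    have h3 := Real.pi_le_four
    rw [Finset.mem_Icc]
    constructor
    · rw [Int.le_floor]
      push_cast
      nlinarith
    · have : (⌊n * w.arg⌋ : ℝ) ≤ ((4 * n : ℤ) : ℝ) := by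
        refine (Int.floor_le _).trans ?_
        push_cast
        nlinarith
      exact_mod_cast this
  have hexp : ∀ ξ : ℂ, ‖ξ‖ = 1 → ξ = Complex.exp (ξ.arg * Complex.I) := by
    intro ξ h
    have := Complex.norm_mul_exp_arg_mul_I ξ
    rw [h] at this
    simpa using this.symm
  refine ⟨Finset.Icc (-(4 * n : ℤ)) (4 * n), inferInstance, fun w => ⟨_, hmem w⟩, ?_, ?_, ?_⟩
  · intro k
    have : (fun w : ℂ => (⟨_, hmem w⟩ : Finset.Icc (-(4 * n : ℤ)) (4 * n))) ⁻¹' {k} =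
        (fun w : ℂ => ⌊n * w.arg⌋) ⁻¹' {(k : ℤ)} := by
      ext w
      simp [Subtype.ext_iff]
    rw [this]
    exact (Int.measurable_floor.comp (Complex.measurable_arg.const_mul _))
      (measurableSet_singleton _)
  · intro ξ ξ' h h' hq
    have hq' : ⌊n * ξ.arg⌋ = ⌊n * ξ'.arg⌋ := by simpa [Subtype.ext_iff] using hq
    have hlt := Int.abs_sub_lt_one_of_floor_eq_floor hq'
    rw [← mul_sub, abs_mul, abs_of_pos hn'] at hlt
    rw [hexp ξ h, hexp ξ' h']
    refine (norm_exp_I_sub_le _ _).trans ?_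
    rw [le_div_iff₀ hn', mul_comm]
    exact hlt.le
  -- The exceptional points are the branch cut of the argument and the endpoints of the arcs.
  · refine ⟨{-1} ∪ Set.range fun m : ℤ => Complex.exp (((m / n : ℝ) : ℂ) * Complex.I),
      (Set.countable_singleton _).union (Set.countable_range _), ?_⟩
    intro ξ h hF
    have hsl : ξ ∈ Complex.slitPlane := by
      rw [Complex.mem_slitPlane_iff_arg]
      refine ⟨fun hpi => hF (Or.inl ?_), fun h0 => by simp [h0] at h⟩
      rw [Set.mem_singleton_iff, hexp ξ h, hpi]
      exact Complex.exp_pi_mul_I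
    have hne : n * ξ.arg ≠ (⌊n * ξ.arg⌋ : ℤ) := by
      intro he
      refine hF (Or.inr ⟨⌊n * ξ.arg⌋, ?_⟩)
      simp only
      rw [← he, mul_div_cancel_left₀ _ hn'.ne', ← hexp ξ h]
    have hcont : ContinuousAt (fun w : ℂ => n * w.arg) ξ :=
      continuousAt_const.mul (Complex.continuousAt_arg hsl)
    have hlo : (⌊n * ξ.arg⌋ : ℝ) < n * ξ.arg := lt_of_le_of_ne (Int.floor_le _) hne.symm
    filter_upwards [hcont.eventually (lt_mem_nhds hlo),
      hcont.eventually (gt_mem_nhds (Int.lt_floor_add_one (n * ξ.arg)))] with w h1 h2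
    rw [Subtype.mk.injEq, Int.floor_eq_iff]
    exact ⟨h1.le, h2⟩

section Average

variable {X Y : ℂ → ℝ}

lemma avg_mono (hX : CircleIntegrable X 0 1) (hY : CircleIntegrable Y 0 1)
    (h : ∀ ξ : ℂ, ‖ξ‖ = 1 → X ξ ≤ Y ξ) : avg X ≤ avg Y :=
  Real.circleAverage_mono hX hY fun ξ hξ => h ξ (by simpa using hξ)

lemma avg_nonneg (h : ∀ ξ : ℂ, ‖ξ‖ = 1 → 0 ≤ X ξ) : 0 ≤ avg X :=
  Real.circleAverage_nonneg_of_nonneg fun ξ hξ => h ξ (by simpa using hξ)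

lemma avg_const_mul (c : ℝ) (X : ℂ → ℝ) : avg (fun ξ => c * X ξ) = c * avg X :=
  Real.circleAverage_fun_smul (a := c) (f := X)

lemma circleIntegrable_of_continuousOn (h : ContinuousOn X (Metric.sphere 0 1)) :
    CircleIntegrable X 0 1 := h.circleIntegrable zero_le_one

lemma CircleIntegrable.const_mul' (c : ℝ) (hX : CircleIntegrable X 0 1) :
    CircleIntegrable (fun ξ => c * X ξ) 0 1 := hX.const_smul (a := c)

lemma CircleIntegrable.continuousOn_mul' (hX : ContinuousOn X (Metric.sphere 0 1))
    (hY : CircleIntegrable Y 0 1) : CircleIntegrable (fun ξ => X ξ * Y ξ) 0 1 :=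
  hY.continuousOn_mul (by simpa using hX)

end Average

section Cells

variable {κ : Type*} [DecidableEq κ] {q : ℂ → κ} {d : ℝ}

lemma cellInd_nonneg (k : κ) (ξ : ℂ) : 0 ≤ cellInd q k ξ := by
  unfold cellInd; split_ifs <;> norm_num

lemma cellInd_le_one (k : κ) (ξ : ℂ) : cellInd q k ξ ≤ 1 := by
  unfold cellInd; split_ifs <;> norm_num

lemma comp_cell_eq_sum [Fintype κ] (c : κ → ℝ) (ξ : ℂ) : c (q ξ) = ∑ k, c k * cellInd q k ξ := by
  simp [cellInd]

variable (hq : IsCirclePartition q d)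
include hq

lemma circleIntegrable_cellInd (k : κ) : CircleIntegrable (cellInd q k) 0 1 := by
  have hm : Measurable (cellInd q k) := Measurable.ite (hq.measurable k) measurable_const
    measurable_const
  have hm' : Measurable fun θ : ℝ => cellInd q k (circleMap 0 1 θ) :=
    hm.comp (continuous_circleMap 0 1).measurable
  refine (intervalIntegrable_const (c := (1 : ℝ))).mono_fun hm'.aestronglyMeasurable ?_
  refine MeasureTheory.ae_of_all _ fun θ => ?_
  change ‖cellInd q k (circleMap 0 1 θ)‖ ≤ ‖(1 : ℝ)‖
  rw [Real.norm_of_nonneg (cellInd_nonneg _ _)]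
  simpa using cellInd_le_one k _

lemma circleIntegrable_mul_cellInd {X : ℂ → ℝ} (hX : ContinuousOn X (Metric.sphere 0 1)) (k : κ) :
    CircleIntegrable (fun ξ => X ξ * cellInd q k ξ) 0 1 :=
  CircleIntegrable.continuousOn_mul' hX (circleIntegrable_cellInd hq k)

variable [Fintype κ]

lemma circleIntegrable_mul_comp {X : ℂ → ℝ} (hX : ContinuousOn X (Metric.sphere 0 1))
    (c : κ → ℝ) : CircleIntegrable (fun ξ => X ξ * c (q ξ)) 0 1 := by
  have : (fun ξ => X ξ * c (q ξ)) = fun ξ => ∑ k, c k * (X ξ * cellInd q k ξ) := by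
    ext ξ
    rw [comp_cell_eq_sum c, Finset.mul_sum]
    exact Finset.sum_congr rfl fun k _ => by ring
  rw [this]
  have := CircleIntegrable.sum Finset.univ (f := fun k ξ => c k * (X ξ * cellInd q k ξ))
    (c := 0) (R := 1)
    (fun k _ => CircleIntegrable.const_mul' (c k) (circleIntegrable_mul_cellInd hq hX k))
  convert! this using 1
  ext ξ
  simp

lemma avg_mul_comp {X : ℂ → ℝ} (hX : ContinuousOn X (Metric.sphere 0 1)) (c : κ → ℝ) :
    avg (fun ξ => X ξ * c (q ξ)) = ∑ k, c k * avg (fun ξ => X ξ * cellInd q k ξ) := by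
  have : (fun ξ => X ξ * c (q ξ)) = fun ξ => ∑ k, c k * (X ξ * cellInd q k ξ) := by
    ext ξ
    rw [comp_cell_eq_sum c, Finset.mul_sum]
    exact Finset.sum_congr rfl fun k _ => by ring
  rw [avg, this, Real.circleAverage_fun_sum
    (fun k _ => CircleIntegrable.const_mul' (c k) (circleIntegrable_mul_cellInd hq hX k))]
  exact Finset.sum_congr rfl fun k _ => avg_const_mul _ _

end Cells

/-! ### The Poisson kernel of the disk. -/

section Poisson

lemma continuousOn_poissonKernel {z : ℂ} (hz : z ∈ Metric.ball (0 : ℂ) 1) :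
    ContinuousOn (poissonKernel 0 z) (Metric.sphere 0 1) := by
  rw [poissonKernel_eq_re_herglotzRieszKernel]
  have := continuousOn_herglotzRieszKernel_sphere hz
  rw [abs_one] at this
  exact Complex.continuous_re.comp_continuousOn this

lemma poissonKernel_eq {z ξ : ℂ} (hξ : ‖ξ‖ = 1) :
    poissonKernel 0 z ξ = (1 - ‖z‖ ^ 2) / ‖ξ - z‖ ^ 2 := by
  simp [poissonKernel_def, hξ]

lemma norm_sub_pos_of_mem_ball {z ξ : ℂ} (hz : z ∈ Metric.ball (0 : ℂ) 1) (hξ : ‖ξ‖ = 1) :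
    0 < ‖ξ - z‖ := by
  have h1 : ‖z‖ < 1 := by simpa using hz
  have := norm_sub_norm_le ξ z
  linarith

lemma one_sub_sq_pos {z : ℂ} (hz : z ∈ Metric.ball (0 : ℂ) 1) : 0 < 1 - ‖z‖ ^ 2 := by
  have h1 : ‖z‖ < 1 := by simpa using hz
  nlinarith [norm_nonneg z]

/-- The kernel cancels the squared distance, so the mean of |ξ - z|² under harmonic measure at z is
exactly 1 - |z|². -/
lemma poissonKernel_mul_sq {z ξ : ℂ} (hz : z ∈ Metric.ball (0 : ℂ) 1) (hξ : ‖ξ‖ = 1) :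
    poissonKernel 0 z ξ * ‖ξ - z‖ ^ 2 = 1 - ‖z‖ ^ 2 := by
  rw [poissonKernel_eq hξ, div_mul_cancel₀]
  exact pow_ne_zero _ (norm_sub_pos_of_mem_ball hz hξ).ne'

lemma poissonKernel_nonneg {z ξ : ℂ} (hz : z ∈ Metric.ball (0 : ℂ) 1) (hξ : ‖ξ‖ = 1) :
    0 ≤ poissonKernel 0 z ξ := by
  rw [poissonKernel_eq hξ]
  have := one_sub_sq_pos hz
  positivity

/-- Poisson's formula for the constant function 1. -/
lemma avg_poissonKernel {z : ℂ} (hz : z ∈ Metric.ball (0 : ℂ) 1) : avg (poissonKernel 0 z) = 1 := by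
  have h : DiffContOnCl ℂ (fun _ : ℂ => (1 : ℝ) • (1 : ℂ)) (Metric.ball 0 1) := diffContOnCl_const
  have := h.circleAverage_poissonKernel_smul hz
  have h2 := Complex.reCLM.circleAverage_comp_comm (c := 0) (R := 1)
    (f := poissonKernel 0 z • fun _ : ℂ => (1 : ℝ) • (1 : ℂ)) (by
      refine ContinuousOn.circleIntegrable zero_le_one ?_
      exact (continuousOn_poissonKernel hz).smul continuousOn_const)
  rw [this] at h2
  simpa [Function.comp_def] using h2

/-- The Poisson kernel is Lipschitz on the unit circle. -/
lemma poissonKernel_le_add {z ξ ξ' : ℂ} {r : ℝ} (hr : r < 1) (hz : ‖z‖ ≤ r) (hξ : ‖ξ‖ = 1)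
    (hξ' : ‖ξ'‖ = 1) :
    poissonKernel 0 z ξ ≤ poissonKernel 0 z ξ' + 4 / (1 - r) ^ 4 * ‖ξ - ξ'‖ := by
  have hzb : z ∈ Metric.ball (0 : ℂ) 1 := by simpa using hz.trans_lt hr
  have h1r : 0 < 1 - r := by linarith
  have ha := norm_sub_norm_le ξ z
  have hb := norm_sub_norm_le ξ' z
  have ha2 := norm_sub_le ξ z
  have hb2 := norm_sub_le ξ' z
  rw [poissonKernel_eq hξ, poissonKernel_eq hξ']
  have hab : |‖ξ' - z‖ - ‖ξ - z‖| ≤ ‖ξ - ξ'‖ := by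
    refine (abs_norm_sub_norm_le _ _).trans (le_of_eq ?_)
    rw [← norm_neg]
    congr 1
    ring
  have hz0 := norm_nonneg z
  set a := ‖ξ - z‖
  set b := ‖ξ' - z‖
  set t := ‖ξ - ξ'‖
  have ha1 : 1 - r ≤ a := by linarith
  have hb1 : 1 - r ≤ b := by linarith
  have ha3 : a ≤ 2 := by linarith
  have hb3 : b ≤ 2 := by linarith
  have hap : 0 < a := by linarith
  have hbp : 0 < b := by linarith
  have hs := one_sub_sq_pos hzb
  have hs1 : 1 - ‖z‖ ^ 2 ≤ 1 := by nlinarith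
  have hab1 := (abs_le.1 hab)
  have key : (1 - ‖z‖ ^ 2) / a ^ 2 - (1 - ‖z‖ ^ 2) / b ^ 2 ≤ 4 / (1 - r) ^ 4 * t := by
    have e : (1 - ‖z‖ ^ 2) / a ^ 2 - (1 - ‖z‖ ^ 2) / b ^ 2 =
        (1 - ‖z‖ ^ 2) * ((b - a) * (b + a)) / (a ^ 2 * b ^ 2) := by
      field_simp
      ring
    have ht : 0 ≤ t := norm_nonneg _
    have hnum : (1 - ‖z‖ ^ 2) * ((b - a) * (b + a)) ≤ 4 * t := by
      have h1 : (b - a) * (b + a) ≤ t * 4 := by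
        have : (b - a) * (b + a) ≤ t * (b + a) := by
          apply mul_le_mul_of_nonneg_right _ (by linarith); linarith
        nlinarith
      calc (1 - ‖z‖ ^ 2) * ((b - a) * (b + a)) ≤ (1 - ‖z‖ ^ 2) * (t * 4) :=
            mul_le_mul_of_nonneg_left h1 hs.le
        _ ≤ 1 * (t * 4) := mul_le_mul_of_nonneg_right hs1 (by positivity)
        _ = 4 * t := by ring
    have hden : (1 - r) ^ 4 ≤ a ^ 2 * b ^ 2 := by
      calc (1 - r) ^ 4 = (1 - r) ^ 2 * (1 - r) ^ 2 := by ring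
        _ ≤ a ^ 2 * b ^ 2 := by gcongr
    rw [e, div_mul_eq_mul_div]
    exact div_le_div₀ (by positivity) hnum (by positivity) hden
  linarith

end Poisson

/-! ### Harmonic measures of the cells. -/

section CellPoisson

variable {κ : Type*} [DecidableEq κ] (q : ℂ → κ)

/-- The analytic function whose real part is the harmonic measure of the cell `{q = k}`. -/
noncomputable def cellHerglotz (k : κ) (z : ℂ) : ℂ :=
  Real.circleAverage (fun ξ => herglotzRieszKernel 0 z ξ • (cellInd q k ξ : ℂ)) 0 1

/-- The harmonic measure of the cell `{q = k}`. -/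
noncomputable def cellPoisson (k : κ) (z : ℂ) : ℝ := (cellHerglotz q k z).re

variable {q} {d : ℝ} (hq : IsCirclePartition q d)
include hq

lemma differentiableOn_cellHerglotz (k : κ) :
    DifferentiableOn ℂ (cellHerglotz q k) (Metric.ball 0 1) := by
  refine differentiableOn_circleAverage_herglotzRieszKernel_smul ?_
  have := circleIntegrable_cellInd hq k
  simp only [CircleIntegrable, intervalIntegrable_iff] at this ⊢
  exact Complex.ofRealCLM.integrable_comp this

lemma continuousOn_cellPoisson (k : κ) : ContinuousOn (cellPoisson q k) (Metric.ball 0 1) :=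
  Complex.continuous_re.comp_continuousOn (differentiableOn_cellHerglotz hq k).continuousOn

lemma cellPoisson_eq {z : ℂ} (hz : z ∈ Metric.ball (0 : ℂ) 1) (k : κ) :
    cellPoisson q k z = avg (fun ξ => poissonKernel 0 z ξ * cellInd q k ξ) := by
  rw [cellPoisson, cellHerglotz,
    re_circleAverage_herglotzRieszKernel_smul (circleIntegrable_cellInd hq k) hz,
    ← poissonKernel_eq_re_herglotzRieszKernel]
  rfl

lemma cellPoisson_nonneg {z : ℂ} (hz : z ∈ Metric.ball (0 : ℂ) 1) (k : κ) :
    0 ≤ cellPoisson q k z := by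
  rw [cellPoisson_eq hq hz]
  exact avg_nonneg fun ξ hξ => mul_nonneg (poissonKernel_nonneg hz hξ) (cellInd_nonneg k ξ)

lemma sum_cellPoisson_mul [Fintype κ] {z : ℂ} (hz : z ∈ Metric.ball (0 : ℂ) 1) (c : κ → ℝ) :
    ∑ k, cellPoisson q k z * c k = avg (fun ξ => poissonKernel 0 z ξ * c (q ξ)) := by
  rw [avg_mul_comp hq (continuousOn_poissonKernel hz)]
  exact Finset.sum_congr rfl fun k _ => by rw [cellPoisson_eq hq hz, mul_comm]

lemma sum_cellPoisson [Fintype κ] {z : ℂ} (hz : z ∈ Metric.ball (0 : ℂ) 1) :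
    ∑ k, cellPoisson q k z = 1 := by
  have := sum_cellPoisson_mul hq hz (fun _ => 1)
  simp only [mul_one] at this
  rw [this]
  exact avg_poissonKernel hz

lemma cellPoisson_le_one [Fintype κ] {z : ℂ} (hz : z ∈ Metric.ball (0 : ℂ) 1) (k : κ) :
    cellPoisson q k z ≤ 1 := by
  rw [← sum_cellPoisson hq hz]
  exact Finset.single_le_sum (fun k _ => cellPoisson_nonneg hq hz k) (Finset.mem_univ k)

/-- The complement of the cell stays at distance at least e/2 from z, where the Poisson kernel is at
most (1 - |z|²) · 4/e². -/
lemma one_sub_cellPoisson_le {z ξ : ℂ} (hz : z ∈ Metric.ball (0 : ℂ) 1) {k : κ} {e : ℝ}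
    (he : 0 < e) (hball : ∀ w ∈ Metric.ball ξ e, q w = k) (hzξ : ‖z - ξ‖ ≤ e / 2) :
    1 - cellPoisson q k z ≤ (1 - ‖z‖ ^ 2) * (4 / e ^ 2) := by
  have hP := circleIntegrable_of_continuousOn (continuousOn_poissonKernel hz)
  have hPi := circleIntegrable_mul_cellInd hq (continuousOn_poissonKernel hz) k
  rw [cellPoisson_eq hq hz, ← avg_poissonKernel hz, ← Real.circleAverage_fun_sub hP hPi]
  have hc : avg (fun _ => (1 - ‖z‖ ^ 2) * (4 / e ^ 2)) = (1 - ‖z‖ ^ 2) * (4 / e ^ 2) :=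
    Real.circleAverage_const _ _ _
  rw [avg_poissonKernel hz, ← hc]
  refine avg_mono (hP.fun_sub hPi) (circleIntegrable_const _ _ _) fun w hw => ?_
  have hs := one_sub_sq_pos hz
  by_cases hk : q w = k
  · simp only [cellInd, hk, if_true, mul_one, sub_self]
    positivity
  · simp only [cellInd, hk, if_false, mul_zero, sub_zero]
    have h1 : e ≤ ‖w - ξ‖ := by
      by_contra hlt
      exact hk (hball w (by simpa [dist_eq_norm] using hlt))
    have h2 : e / 2 ≤ ‖w - z‖ := by
      have := norm_sub_le_norm_sub_add_norm_sub w z ξ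
      linarith
    have h3 := norm_sub_pos_of_mem_ball hz hw
    rw [poissonKernel_eq hw, div_eq_mul_inv]
    refine mul_le_mul_of_nonneg_left ?_ hs.le
    rw [inv_le_comm₀ (by positivity) (by positivity), inv_div]
    calc e ^ 2 / 4 = (e / 2) ^ 2 := by ring
      _ ≤ _ := by gcongr

/-- The harmonic measure of a cell tends to one inside this cell, in the mean. -/
lemma tendsto_avg_one_sub_cellPoisson [Fintype κ] (k : κ) :
    Tendsto (fun s : ℝ => avg (fun ξ => (1 - cellPoisson q k (s * ξ)) * cellInd q k ξ))
      (𝓝[<] 1) (𝓝 0) := by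
  obtain ⟨F, hF, hloc⟩ := hq.locally_const
  have hev : ∀ᶠ s : ℝ in 𝓝[<] 1, 0 < s ∧ s < 1 := by
    filter_upwards [self_mem_nhdsWithin, mem_nhdsWithin_of_mem_nhds (lt_mem_nhds zero_lt_one)]
      with s h1 h2 using ⟨h2, h1⟩
  have hball : ∀ s : ℝ, 0 < s → s < 1 → ∀ θ : ℝ, (s : ℂ) * circleMap 0 1 θ ∈
      Metric.ball (0 : ℂ) 1 := by
    intro s h0 h1 θ
    simp [abs_of_pos h0, h1]
  have hmc : Measurable fun θ : ℝ => cellInd q k (circleMap 0 1 θ) :=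
    (Measurable.ite (hq.measurable k) measurable_const measurable_const).comp
      (continuous_circleMap 0 1).measurable
  have key := intervalIntegral.tendsto_integral_filter_of_dominated_convergence
    (μ := MeasureTheory.volume) (a := 0) (b := 2 * Real.pi) (l := 𝓝[<] (1 : ℝ))
    (F := fun s θ => (1 - cellPoisson q k (s * circleMap 0 1 θ)) * cellInd q k (circleMap 0 1 θ))
    (f := fun _ => (0 : ℝ)) (bound := fun _ => 1) ?_ ?_ ?_ ?_
  · have := key.const_smul (2 * Real.pi)⁻¹
    simpa [avg, Real.circleAverage_def] using this
  · filter_upwards [hev] with s hs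
    refine (Measurable.mul ?_ hmc).aestronglyMeasurable
    refine measurable_const.sub (Continuous.measurable ?_)
    exact (continuousOn_cellPoisson hq k).comp_continuous (by fun_prop) (hball s hs.1 hs.2)
  · filter_upwards [hev] with s hs
    refine MeasureTheory.ae_of_all _ fun θ _ => ?_
    have hz := hball s hs.1 hs.2 θ
    have h1 := cellPoisson_nonneg hq hz k
    have h2 := cellPoisson_le_one hq hz k
    have h3 := cellInd_nonneg (q := q) k (circleMap 0 1 θ)
    have h4 := cellInd_le_one (q := q) k (circleMap 0 1 θ)
    rw [Real.norm_of_nonneg (mul_nonneg (by linarith) h3)]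
    nlinarith
  · exact intervalIntegrable_const
  -- Off a countable set, hence for almost every angle, the partition is constant near the boundary
  -- point. The preceding estimate then gives the radial limit directly, without Fatou's theorem.
  · have hnull := (hF.preimage_circleMap 0 (one_ne_zero : (1 : ℝ) ≠ 0)).ae_notMem
      MeasureTheory.volume
    filter_upwards [hnull] with θ hθ _
    have hξ : ‖circleMap 0 1 θ‖ = 1 := by simp
    by_cases hk : q (circleMap 0 1 θ) = k
    swap
    · simp only [cellInd, hk, if_false, mul_zero]
      exact tendsto_const_nhds
    obtain ⟨e, he, hball'⟩ := Metric.eventually_nhds_iff_ball.1 (hloc _ hξ hθ)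
    have hlim : Tendsto (fun s : ℝ => (1 - s ^ 2) * (4 / e ^ 2)) (𝓝[<] 1) (𝓝 0) := by
      have : Tendsto (fun s : ℝ => (1 - s ^ 2) * (4 / e ^ 2)) (𝓝 1)
          (𝓝 ((1 - 1 ^ 2) * (4 / e ^ 2))) := by
        apply Continuous.tendsto; fun_prop
      simpa using this.mono_left nhdsWithin_le_nhds
    have hclose : ∀ᶠ s : ℝ in 𝓝[<] 1, 1 - e / 2 < s :=
      mem_nhdsWithin_of_mem_nhds (lt_mem_nhds (by linarith))
    refine tendsto_of_tendsto_of_tendsto_of_le_of_le' tendsto_const_nhds hlim ?_ ?_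
    · filter_upwards [hev] with s hs
      exact mul_nonneg (by linarith [cellPoisson_le_one hq (hball s hs.1 hs.2 θ) k])
        (cellInd_nonneg _ _)
    · filter_upwards [hev, hclose] with s hs hs'
      have hz := hball s hs.1 hs.2 θ
      have hn : ‖(s : ℂ) * circleMap 0 1 θ‖ = s := by simp [abs_of_pos hs.1]
      have := one_sub_cellPoisson_le hq hz he (k := k) (ξ := circleMap 0 1 θ)
        (fun w hw => (hball' w hw).trans hk) (by
          have : (s : ℂ) * circleMap 0 1 θ - circleMap 0 1 θ =
              ((s - 1 : ℝ) : ℂ) * circleMap 0 1 θ := by push_cast; ring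
          rw [this, norm_mul, hξ, mul_one, Complex.norm_real, Real.norm_eq_abs, abs_le]
          constructor <;> linarith [hs.2])
      rw [hn] at this
      simpa [cellInd, hk] using this

end CellPoisson

/-! ### Outer functions with modulus constant on cells. -/

section Outer

variable {ι κ : Type*} [Fintype κ] [DecidableEq κ]

/-- The outer function with modulus `m k j` on the cell `{q = k}` in the `j`-th coordinate. -/
noncomputable def outer (q : ℂ → κ) (m : κ → ι → ℝ) (z : ℂ) (j : ι) : ℂ :=
  Complex.exp (∑ k, (Real.log (m k j) : ℂ) * cellHerglotz q k z)

variable {q : ℂ → κ} {d : ℝ} {m : κ → ι → ℝ}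

lemma outer_ne_zero (z : ℂ) (j : ι) : outer q m z j ≠ 0 := Complex.exp_ne_zero _

lemma norm_outer_pos (z : ℂ) (j : ι) : 0 < ‖outer q m z j‖ := norm_pos_iff.2 (outer_ne_zero z j)

lemma norm_outer (z : ℂ) (j : ι) :
    ‖outer q m z j‖ = Real.exp (∑ k, cellPoisson q k z * Real.log (m k j)) := by
  rw [outer, Complex.norm_exp, Complex.re_sum]
  congr 1
  refine Finset.sum_congr rfl fun k _ => ?_
  rw [Complex.re_ofReal_mul, cellPoisson, mul_comm]

variable (hq : IsCirclePartition q d)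
include hq

lemma differentiableOn_outer (j : ι) :
    DifferentiableOn ℂ (fun z => outer q m z j) (Metric.ball 0 1) := by
  refine DifferentiableOn.cexp (DifferentiableOn.fun_sum fun k _ => ?_)
  exact (differentiableOn_cellHerglotz hq k).const_mul _

variable {z : ℂ} (hz : z ∈ Metric.ball (0 : ℂ) 1)
include hz

/-- Jensen's inequality for exp: |ψ| is a geometric mean of the m k with the harmonic measures as
weights. -/
lemma norm_outer_le (hm : ∀ k j, 0 < m k j) (j : ι) :
    ‖outer q m z j‖ ≤ ∑ k, cellPoisson q k z * m k j := by
  rw [norm_outer]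
  have := convexOn_exp.map_sum_le (t := Finset.univ) (w := fun k => cellPoisson q k z)
    (p := fun k => Real.log (m k j)) (fun k _ => cellPoisson_nonneg hq hz k)
    (sum_cellPoisson hq hz) (fun _ _ => Set.mem_univ _)
  simpa [Real.exp_log (hm _ j)] using this

lemma norm_outer_inv_le (hm : ∀ k j, 0 < m k j) (j : ι) :
    ‖outer q m z j‖⁻¹ ≤ ∑ k, cellPoisson q k z * (m k j)⁻¹ := by
  rw [norm_outer, ← Real.exp_neg]
  have := convexOn_exp.map_sum_le (t := Finset.univ) (w := fun k => cellPoisson q k z)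
    (p := fun k => -Real.log (m k j)) (fun k _ => cellPoisson_nonneg hq hz k)
    (sum_cellPoisson hq hz) (fun _ _ => Set.mem_univ _)
  simpa [Real.exp_neg, Real.exp_log (hm _ j)] using this

/-- Inside the k-th cell, near the circle, the k-th weight is close to 1 and |ψ| is nearly m k. The
error depends on m only through the bound `L` on its logarithms, which allows a choice of radius
uniform over all weights. -/
lemma le_norm_outer_mul (hm : ∀ k j, 0 < m k j) {L : ℝ} (hL : ∀ k j, |Real.log (m k j)| ≤ L)
    (k : κ) (j : ι) :
    m k j ≤ ‖outer q m z j‖ * (1 + (Real.exp (2 * L) - 1) * (1 - cellPoisson q k z)) := by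
  set p := fun k => cellPoisson q k z with hp
  have hp0 : ∀ k, 0 ≤ p k := fun k => cellPoisson_nonneg hq hz k
  have hp1 : ∑ k, p k = 1 := sum_cellPoisson hq hz
  have hpk : p k ≤ 1 := cellPoisson_le_one hq hz k
  -- The term i = k drops out. The other weights add up to 1 - p k, and each difference of
  -- logarithms is at most 2L.
  have hlog : Real.log (m k j) ≤ (∑ i, p i * Real.log (m i j)) + (1 - p k) * (2 * L) := by
    have h1 : Real.log (m k j) - ∑ i, p i * Real.log (m i j) =
        ∑ i, p i * (Real.log (m k j) - Real.log (m i j)) := by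
      simp only [mul_sub, Finset.sum_sub_distrib, ← Finset.sum_mul, hp1, one_mul]
    have h2 : ∑ i, p i * (Real.log (m k j) - Real.log (m i j)) ≤
        ∑ i, (p i * (2 * L) - if i = k then p i * (2 * L) else 0) := by
      refine Finset.sum_le_sum fun i _ => ?_
      by_cases hi : i = k
      · subst hi; simp
      · rw [if_neg hi, sub_zero]
        refine mul_le_mul_of_nonneg_left ?_ (hp0 i)
        linarith [(abs_le.1 (hL k j)).2, (abs_le.1 (hL i j)).1]
    rw [Finset.sum_sub_distrib, ← Finset.sum_mul, hp1, Finset.sum_ite_eq' Finset.univ k] at h2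
    simp only [Finset.mem_univ, if_true] at h2
    linarith
  -- The graph of exp lies below its chord over [0, 2L].
  have hexp : Real.exp ((1 - p k) * (2 * L)) ≤ 1 + (Real.exp (2 * L) - 1) * (1 - p k) := by
    have := convexOn_exp.2 (Set.mem_univ 0) (Set.mem_univ (2 * L)) (hp0 k)
      (sub_nonneg.2 hpk) (by ring)
    simp only [smul_eq_mul, mul_zero, zero_add, Real.exp_zero, mul_one] at this
    linarith
  rw [norm_outer]
  calc m k j = Real.exp (Real.log (m k j)) := (Real.exp_log (hm k j)).symm
    _ ≤ Real.exp ((∑ i, p i * Real.log (m i j)) + (1 - p k) * (2 * L)) := Real.exp_le_exp.2 hlog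
    _ = Real.exp (∑ i, p i * Real.log (m i j)) * Real.exp ((1 - p k) * (2 * L)) := Real.exp_add _ _
    _ ≤ _ := mul_le_mul_of_nonneg_left hexp (Real.exp_pos _).le

/-- By Jensen, |ψ| is at most a convex combination of the m k, and the norm is convex. -/
lemma latticeNorm_outer_le {N : (ι → ℝ) → ℝ} (hN : IsLatticeNorm N) (hm : ∀ k j, 0 < m k j)
    {B : ℝ} (hB : ∀ k, N (m k) ≤ B) : N (fun j => ‖outer q m z j‖) ≤ B := by
  have hp0 : ∀ k, 0 ≤ cellPoisson q k z := fun k => cellPoisson_nonneg hq hz k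
  calc N (fun j => ‖outer q m z j‖) ≤ N (∑ k, cellPoisson q k z • m k) := by
        refine hN.mono _ _ fun j => ?_
        rw [abs_of_nonneg (norm_nonneg _)]
        refine (norm_outer_le hq hz hm j).trans ((le_of_eq ?_).trans (le_abs_self _))
        simp
    _ ≤ ∑ k, N (cellPoisson q k z • m k) := hN.sum_le _ _
    _ = ∑ k, cellPoisson q k z * N (m k) :=
        Finset.sum_congr rfl fun k _ => hN.smul_nonneg (hp0 k) _
    _ ≤ ∑ k, cellPoisson q k z * B :=
        Finset.sum_le_sum fun k _ => mul_le_mul_of_nonneg_left (hB k) (hp0 k)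
    _ = B := by rw [← Finset.sum_mul, sum_cellPoisson hq hz, one_mul]

/-- The function 1/ψ is outer with moduli 1/m, so the same convexity argument applies. -/
lemma latticeNorm_div_outer_le {N : (ι → ℝ) → ℝ} (hN : IsLatticeNorm N) (hm : ∀ k j, 0 < m k j)
    (x : ι → ℂ) :
    N (fun j => ‖x j / outer q m z j‖) ≤ ∑ k, cellPoisson q k z * N (fun j => ‖x j‖ / m k j) := by
  have hp0 : ∀ k, 0 ≤ cellPoisson q k z := fun k => cellPoisson_nonneg hq hz k
  calc N (fun j => ‖x j / outer q m z j‖)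
      ≤ N (∑ k, cellPoisson q k z • fun j => ‖x j‖ / m k j) := by
        refine hN.mono _ _ fun j => ?_
        rw [abs_of_nonneg (norm_nonneg _), norm_div, div_eq_mul_inv]
        refine (mul_le_mul_of_nonneg_left (norm_outer_inv_le hq hz hm j) (norm_nonneg _)).trans
          ((le_of_eq ?_).trans (le_abs_self _))
        simp only [Finset.sum_apply, Pi.smul_apply, smul_eq_mul, Finset.mul_sum]
        exact Finset.sum_congr rfl fun k _ => by ring
    _ ≤ ∑ k, N (cellPoisson q k z • fun j => ‖x j‖ / m k j) := hN.sum_le _ _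
    _ = _ := Finset.sum_congr rfl fun k _ => hN.smul_nonneg (hp0 k) _

/-- If `f / a` has norm at most `A` on the cells and `m ≥ a`, then `f / ψ` has norm almost at most
`A` near the unit circle, where `ψ` is the outer function of modulus `m`. -/
lemma latticeNorm_div_outer_le_of_lipschitz {N : (ι → ℝ) → ℝ} (hN : IsLatticeNorm N)
    {f : ℂ → ι → ℂ} {Λ η A e : ℝ} (hΛ : 0 ≤ Λ) (hη : 0 < η) (he : 0 < e)
    (hf : ∀ w ∈ Metric.closedBall (0 : ℂ) 1, ∀ w' ∈ Metric.closedBall (0 : ℂ) 1, ∀ j,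
      ‖f w j - f w' j‖ ≤ Λ * ‖w - w'‖)
    {a : κ → ι → ℝ} (ha : ∀ k j, η ≤ a k j) (ham : ∀ k j, a k j ≤ m k j)
    (hA : ∀ ξ : ℂ, ‖ξ‖ = 1 → ∃ ξ' : ℂ, ‖ξ'‖ = 1 ∧ q ξ' = q ξ ∧
      N (fun j => ‖f ξ' j‖ / a (q ξ) j) ≤ A) :
    N (fun j => ‖f z j / outer q m z j‖) ≤
      A + N (fun _ => 1) * Λ / η * (d + e + (1 - ‖z‖ ^ 2) / (4 * e)) := by
  have ha0 : ∀ k j, 0 < a k j := fun k j => hη.trans_le (ha k j)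
  have hm : ∀ k j, 0 < m k j := fun k j => (ha0 k j).trans_le (ham k j)
  have hzc : z ∈ Metric.closedBall (0 : ℂ) 1 := Metric.ball_subset_closedBall hz
  set c := N (fun _ => 1) * Λ / η with hc
  have hc0 : 0 ≤ c := div_nonneg (mul_nonneg (hN.nonneg _) hΛ) hη.le
  have hcell : ∀ ξ : ℂ, ‖ξ‖ = 1 → N (fun j => ‖f z j‖ / m (q ξ) j) ≤ A + c * (‖ξ - z‖ + d) := by
    intro ξ hξ
    obtain ⟨ξ', hξ', hqq, hA'⟩ := hA ξ hξ
    have hξc : ξ' ∈ Metric.closedBall (0 : ℂ) 1 := by simp [hξ']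
    have h1 : N (fun j => ‖f z j‖ / m (q ξ) j) ≤ N ((fun j => ‖f ξ' j‖ / a (q ξ) j) +
        (Λ * ‖z - ξ'‖ / η) • fun _ => 1) := by
      refine hN.mono _ _ fun j => ?_
      rw [abs_of_nonneg (div_nonneg (norm_nonneg _) (hm _ _).le)]
      refine le_trans ?_ (le_abs_self _)
      simp only [Pi.add_apply, Pi.smul_apply, smul_eq_mul, mul_one]
      have h2 : ‖f z j‖ ≤ ‖f ξ' j‖ + Λ * ‖z - ξ'‖ := by
        have h3 := hf z hzc ξ' hξc j
        have h4 := norm_sub_norm_le (f z j) (f ξ' j)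
        linarith
      calc ‖f z j‖ / m (q ξ) j ≤ ‖f z j‖ / a (q ξ) j :=
            div_le_div_of_nonneg_left (norm_nonneg _) (ha0 _ _) (ham _ _)
        _ ≤ (‖f ξ' j‖ + Λ * ‖z - ξ'‖) / a (q ξ) j :=
            div_le_div_of_nonneg_right h2 (ha0 _ _).le
        _ = ‖f ξ' j‖ / a (q ξ) j + Λ * ‖z - ξ'‖ / a (q ξ) j := add_div _ _ _
        _ ≤ ‖f ξ' j‖ / a (q ξ) j + Λ * ‖z - ξ'‖ / η := by
            gcongr
            exact ha _ _
    refine h1.trans ((hN.add_le _ _).trans ?_)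
    rw [hN.smul_nonneg (by positivity)]
    have h5 : ‖z - ξ'‖ ≤ ‖ξ - z‖ + d := by
      have h6 := hq.diam ξ ξ' hξ hξ' hqq.symm
      have h7 := norm_sub_le_norm_sub_add_norm_sub z ξ ξ'
      rw [norm_sub_rev z ξ] at h7
      linarith
    have h8 : Λ * ‖z - ξ'‖ / η * N (fun _ => 1) = c * ‖z - ξ'‖ := by rw [hc]; ring
    rw [h8]
    exact add_le_add hA' (mul_le_mul_of_nonneg_left h5 hc0)
  refine (latticeNorm_div_outer_le hq hz hN hm (f z)).trans ?_
  rw [sum_cellPoisson_mul hq hz fun k => N (fun j => ‖f z j‖ / m k j)]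
  have hPc := continuousOn_poissonKernel hz
  have hP := circleIntegrable_of_continuousOn hPc
  set E := A + c * (d + e) with hE
  set G := c * ((1 - ‖z‖ ^ 2) / (4 * e)) with hG
  have hfin : avg (fun ξ => E * poissonKernel 0 z ξ + G) = E + G := by
    rw [avg, Real.circleAverage_fun_add (CircleIntegrable.const_mul' E hP)
      (circleIntegrable_const _ _ _), Real.circleAverage_const,
      show Real.circleAverage (fun ξ => E * poissonKernel 0 z ξ) 0 1 = E * avg (poissonKernel 0 z)
        from avg_const_mul _ _, avg_poissonKernel hz, mul_one]
  have : A + c * (d + e + (1 - ‖z‖ ^ 2) / (4 * e)) = E + G := by rw [hE, hG]; ring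
  rw [this, ← hfin]
  refine avg_mono (circleIntegrable_mul_comp hq hPc fun k => N (fun j => ‖f z j‖ / m k j))
    ((CircleIntegrable.const_mul' E hP).fun_add (circleIntegrable_const _ _ _)) fun ξ hξ => ?_
  have hP0 := poissonKernel_nonneg hz hξ
  have hsq := poissonKernel_mul_sq hz hξ
  -- The arithmetic-geometric mean inequality at scale e replaces the distance by its square, whose
  -- Poisson average is known exactly.
  have h9 : ‖ξ - z‖ ≤ e + ‖ξ - z‖ ^ 2 / (4 * e) := by
    rw [← sub_nonneg]
    have : e + ‖ξ - z‖ ^ 2 / (4 * e) - ‖ξ - z‖ = (2 * e - ‖ξ - z‖) ^ 2 / (4 * e) := by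
      field_simp; ring
    rw [this]; positivity
  calc poissonKernel 0 z ξ * N (fun j => ‖f z j‖ / m (q ξ) j)
      ≤ poissonKernel 0 z ξ * (A + c * (e + ‖ξ - z‖ ^ 2 / (4 * e) + d)) := by
        refine mul_le_mul_of_nonneg_left ((hcell ξ hξ).trans ?_) hP0
        gcongr
    _ = E * poissonKernel 0 z ξ + c * ((poissonKernel 0 z ξ * ‖ξ - z‖ ^ 2) / (4 * e)) := by
        rw [hE]; ring
    _ = E * poissonKernel 0 z ξ + G := by rw [hsq]

end Outer

/-! ### Boundary majorants and Poisson averages from cell averages. -/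

/-- A pointwise majorant of the real part of an analytic function on the unit circle majorizes it in
the unit disk, after averaging with the Poisson kernel. -/
lemma re_le_avg_poissonKernel_mul {F : ℂ → ℂ} (hF : DiffContOnCl ℂ F (Metric.ball 0 1))
    {X : ℂ → ℝ} (hX : ContinuousOn X (Metric.sphere 0 1)) (hFX : ∀ ξ : ℂ, ‖ξ‖ = 1 → (F ξ).re ≤ X ξ)
    {z : ℂ} (hz : z ∈ Metric.ball (0 : ℂ) 1) :
    (F z).re ≤ avg (fun ξ => poissonKernel 0 z ξ * X ξ) := by
  have hP := continuousOn_poissonKernel hz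
  have hFs : ContinuousOn F (Metric.sphere 0 1) := by
    refine hF.2.mono ?_
    rw [closure_ball 0 one_ne_zero]
    exact Metric.sphere_subset_closedBall
  have h1 := hF.circleAverage_poissonKernel_smul hz
  have h2 := Complex.reCLM.circleAverage_comp_comm (c := 0) (R := 1)
    (f := poissonKernel 0 z • F) (ContinuousOn.circleIntegrable zero_le_one (hP.smul hFs))
  rw [h1] at h2
  rw [← Complex.reCLM_apply, ← h2]
  refine avg_mono (ContinuousOn.circleIntegrable zero_le_one
    (Complex.reCLM.continuous.comp_continuousOn (hP.smul hFs)))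
    (circleIntegrable_of_continuousOn (hP.mul hX)) fun ξ hξ => ?_
  simp only [Function.comp_apply, Pi.smul_apply', Complex.reCLM_apply, Complex.real_smul,
    Complex.re_ofReal_mul]
  exact mul_le_mul_of_nonneg_left (hFX ξ hξ) (poissonKernel_nonneg hz hξ)

/-- Bounds for the averages over the cells give bounds for the averages against the Poisson
kernel. -/
lemma avg_poissonKernel_mul_le {κ : Type*} [Fintype κ] [DecidableEq κ] {q : ℂ → κ} {d : ℝ}
    (hd : 0 ≤ d) (hq : IsCirclePartition q d) {X : ℂ → ℝ}
    (hX : ContinuousOn X (Metric.sphere 0 1)) (hX0 : ∀ ξ : ℂ, ‖ξ‖ = 1 → 0 ≤ X ξ) {D : ℝ} (hD : 0 ≤ D)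
    (hXD : ∀ k, avg (fun ξ => X ξ * cellInd q k ξ) ≤ D * avg (cellInd q k)) {r : ℝ} (hr : r < 1)
    {z : ℂ} (hz : ‖z‖ ≤ r) :
    avg (fun ξ => poissonKernel 0 z ξ * X ξ) ≤ D * (1 + 8 / (1 - r) ^ 4 * d) := by
  classical
  have hzb : z ∈ Metric.ball (0 : ℂ) 1 := by simpa using hz.trans_lt hr
  have h1r : 0 < 1 - r := by linarith
  have hP := continuousOn_poissonKernel hzb
  set o := 4 / (1 - r) ^ 4 * d with ho
  have ho0 : 0 ≤ o := by positivity
  have hosc : ∀ ξ ξ' : ℂ, ‖ξ‖ = 1 → ‖ξ'‖ = 1 → q ξ = q ξ' →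
      poissonKernel 0 z ξ ≤ poissonKernel 0 z ξ' + o := by
    intro ξ ξ' h h' hqq
    refine (poissonKernel_le_add hr hz h h').trans ?_
    rw [ho]
    gcongr
    exact hq.diam ξ ξ' h h' hqq
  -- On each cell the kernel is replaced by a constant above it. The value at one point of the cell
  -- plus the oscillation `o` is a majorant, and it exceeds the kernel by at most 2o, whence the
  -- constant 8. Empty cells get 0.
  have hT : ∀ k, ∃ T : ℝ, 0 ≤ T ∧ ∀ ξ : ℂ, ‖ξ‖ = 1 → q ξ = k →
      poissonKernel 0 z ξ ≤ T ∧ T ≤ poissonKernel 0 z ξ + 2 * o := by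
    intro k
    by_cases hk : ∃ ξ : ℂ, ‖ξ‖ = 1 ∧ q ξ = k
    · obtain ⟨ζ, hζ, hζk⟩ := hk
      refine ⟨poissonKernel 0 z ζ + o, add_nonneg (poissonKernel_nonneg hzb hζ) ho0,
        fun ξ hξ hξk => ⟨hosc _ _ hξ hζ (hξk.trans hζk.symm), ?_⟩⟩
      have := hosc _ _ hζ hξ (hζk.trans hξk.symm)
      linarith
    · exact ⟨0, le_rfl, fun ξ hξ hξk => absurd ⟨ξ, hξ, hξk⟩ hk⟩
  choose T hT0 hT using hT
  calc avg (fun ξ => poissonKernel 0 z ξ * X ξ)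
      ≤ avg (fun ξ => X ξ * T (q ξ)) := by
        refine avg_mono (circleIntegrable_of_continuousOn (hP.mul hX))
          (circleIntegrable_mul_comp hq hX T) fun ξ hξ => ?_
        rw [mul_comm]
        exact mul_le_mul_of_nonneg_left (hT _ ξ hξ rfl).1 (hX0 ξ hξ)
    _ = ∑ k, T k * avg (fun ξ => X ξ * cellInd q k ξ) := avg_mul_comp hq hX T
    _ ≤ ∑ k, T k * (D * avg (cellInd q k)) :=
        Finset.sum_le_sum fun k _ => mul_le_mul_of_nonneg_left (hXD k) (hT0 k)
    _ = D * avg (fun ξ => 1 * T (q ξ)) := by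
        rw [avg_mul_comp hq continuousOn_const T, Finset.mul_sum]
        simp only [one_mul]
        exact Finset.sum_congr rfl fun k _ => by ring
    _ ≤ D * avg (fun ξ => poissonKernel 0 z ξ + 2 * o) := by
        refine mul_le_mul_of_nonneg_left ?_ hD
        refine avg_mono (circleIntegrable_mul_comp hq continuousOn_const T)
          ((circleIntegrable_of_continuousOn hP).fun_add (circleIntegrable_const _ _ _))
          fun ξ hξ => ?_
        rw [one_mul]
        exact (hT _ ξ hξ rfl).2
    _ = D * (1 + 8 / (1 - r) ^ 4 * d) := by
        rw [avg, Real.circleAverage_fun_add (circleIntegrable_of_continuousOn hP)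
          (circleIntegrable_const _ _ _), Real.circleAverage_const]
        rw [show Real.circleAverage (poissonKernel 0 z) 0 1 = 1 from avg_poissonKernel hzb, ho]
        ring

/-! ### Finite corona property and factorization. -/

section FiniteCorona

variable {ι : Type*}

/-- The corona property for a lattice norm on a finite set of coordinates, with lower bound `δ` and
constant `C`. -/
def HasFiniteCorona [Fintype ι] (N : (ι → ℝ) → ℝ) (δ C : ℝ) : Prop :=
  ∀ φ : ℂ → ι → ℂ, (∀ j, DifferentiableOn ℂ (fun z => φ z j) (Metric.ball 0 1)) →
    (∀ z ∈ Metric.ball (0 : ℂ) 1, δ ≤ N (fun j => ‖φ z j‖) ∧ N (fun j => ‖φ z j‖) ≤ 1) →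
    ∃ g : ℂ → ι → ℂ, (∀ j, DifferentiableOn ℂ (fun z => g z j) (Metric.ball 0 1)) ∧
      (∀ z ∈ Metric.ball (0 : ℂ) 1, ∑ j, φ z j * g z j = 1) ∧
      ∀ z ∈ Metric.ball (0 : ℂ) 1, ∀ x : ι → ℝ, ∑ j, |x j| * ‖g z j‖ ≤ C * N x

/-- Every element of norm less than `A * B` in the product lattice factors through the balls of
radii `A` and `B`. -/
def HasFactorization (N₀ N₁ N : (ι → ℝ) → ℝ) : Prop :=
  ∀ (x : ι → ℝ) (A B : ℝ), 0 < A → 0 < B → N x < A * B →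
    ∃ y w : ι → ℝ, x = y * w ∧ N₀ y ≤ A ∧ N₁ w ≤ B

lemma exists_lipschitz_of_differentiableOn [Fintype ι] {f : ℂ → ι → ℂ} {R : ℝ} (hR : 1 < R)
    (hf : ∀ j, DifferentiableOn ℂ (fun z => f z j) (Metric.ball 0 R)) :
    ∃ Λ : ℝ, 0 ≤ Λ ∧ ∀ w ∈ Metric.closedBall (0 : ℂ) 1, ∀ w' ∈ Metric.closedBall (0 : ℂ) 1, ∀ j,
      ‖f w j - f w' j‖ ≤ Λ * ‖w - w'‖ := by
  have hsub : Metric.closedBall (0 : ℂ) 1 ⊆ Metric.ball 0 R := Metric.closedBall_subset_ball hR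
  have hj : ∀ j, ∃ Λ : ℝ, 0 ≤ Λ ∧ ∀ w ∈ Metric.closedBall (0 : ℂ) 1,
      ∀ w' ∈ Metric.closedBall (0 : ℂ) 1, ‖f w j - f w' j‖ ≤ Λ * ‖w - w'‖ := by
    intro j
    have hd : ContinuousOn (deriv fun z => f z j) (Metric.closedBall 0 1) :=
      ((hf j).deriv Metric.isOpen_ball).continuousOn.mono hsub
    obtain ⟨Λ, hΛ⟩ := (isCompact_closedBall (0 : ℂ) 1).exists_bound_of_continuousOn hd
    refine ⟨Λ, (norm_nonneg _).trans (hΛ 0 (by simp)), fun w hw w' hw' => ?_⟩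
    exact (convex_closedBall (0 : ℂ) 1).norm_image_sub_le_of_norm_deriv_le
      (fun z hz => (hf j).differentiableAt (Metric.isOpen_ball.mem_nhds (hsub hz))) hΛ hw' hw
  choose Λ hΛ0 hΛ using hj
  refine ⟨∑ j, Λ j, Finset.sum_nonneg fun j _ => hΛ0 j, fun w hw w' hw' j => ?_⟩
  refine (hΛ j w hw w' hw').trans (mul_le_mul_of_nonneg_right ?_ (norm_nonneg _))
  exact Finset.single_le_sum (fun j _ => hΛ0 j) (Finset.mem_univ j)

/-- The majorant is the second factor of |x| plus a small constant η. The lower bound η is uniform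
in x, so that division by a is stable and log a is bounded below. -/
lemma exists_majorant_of_factorization {N₀ N₁ N : (ι → ℝ) → ℝ} (h₀ : IsLatticeNorm N₀)
    (h₁ : IsLatticeNorm N₁) (hfac : HasFactorization N₀ N₁ N) {θ : ℝ} (hθ : 0 < θ)
    (hθ' : θ < 1 / 6) :
    ∃ η : ℝ, 0 < η ∧ ∀ x : ι → ℂ, N (fun j => ‖x j‖) ≤ 1 →
      ∃ a : ι → ℝ, (∀ j, η ≤ a j) ∧ N₀ (fun j => ‖x j‖ / a j) ≤ 1 - θ ∧ N₁ a ≤ 1 + 3 * θ := by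
  have hN1 := h₁.nonneg fun _ => 1
  have hη : 0 < θ / (N₁ (fun _ => 1) + 1) := by positivity
  refine ⟨θ / (N₁ (fun _ => 1) + 1), hη, fun x hx => ?_⟩
  set η := θ / (N₁ (fun _ => 1) + 1) with hηd
  -- The radii have product (1 - θ)(1 + 2θ) = 1 + θ(1 - 2θ) > 1, which gives the strict inequality
  -- needed for factorization.
  obtain ⟨y, w, hyw, hy, hw⟩ := hfac (fun j => ‖x j‖) (1 - θ) (1 + 2 * θ) (by linarith)
    (by linarith) (by nlinarith)
  have ha : ∀ j, 0 < |w j| + η := fun j => by positivity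
  refine ⟨fun j => |w j| + η, fun j => by simp, ?_, ?_⟩
  · refine (h₀.mono _ _ fun j => ?_).trans hy
    have : ‖x j‖ = y j * w j := congrFun hyw j
    have h2 : ‖x j‖ = |y j| * |w j| := by rw [← abs_mul, ← this, abs_norm]
    rw [abs_of_nonneg (div_nonneg (norm_nonneg _) (ha j).le), div_le_iff₀ (ha j), h2]
    exact mul_le_mul_of_nonneg_left (by linarith) (abs_nonneg _)
  · have h3 : (fun j => |w j| + η) = (fun j => |w j|) + η • fun _ => (1 : ℝ) := by
      ext j; simp
    rw [h3]
    refine (h₁.add_le _ _).trans ?_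
    rw [h₁.abs_eq, h₁.smul_nonneg hη.le]
    have : η * N₁ (fun _ => 1) ≤ θ := by
      rw [hηd, div_mul_eq_mul_div, div_le_iff₀ (by linarith)]
      nlinarith
    linarith

end FiniteCorona

/-! ### Solutions obtained by dividing by an outer function. -/

section Solution

variable {κ : Type*} [Fintype κ] [DecidableEq κ] {q : ℂ → κ} {d : ℝ}

/-- If G solves the corona problem for f/ψ, then g = G/ψ solves it for f and |g| |ψ| = |G|. The
upper bound for f/ψ is only available on the circle of radius `ρ`. The maximum principle carries it
inside, and dilation by `ρ` restores the unit disk. -/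
lemma exists_solution_div_outer [Fintype ι] {N₀ : (ι → ℝ) → ℝ} (h₀ : IsLatticeNorm N₀) {δ C : ℝ}
    (hcor : HasFiniteCorona N₀ δ C) (hq : IsCirclePartition q d) {m : κ → ι → ℝ} {ρ : ℝ}
    (hρ : 0 < ρ) (hρ' : ρ < 1) {f : ℂ → ι → ℂ}
    (hf : ∀ j, DifferentiableOn ℂ (fun z => f z j) (Metric.ball 0 1))
    (hup : ∀ z ∈ Metric.sphere (0 : ℂ) ρ, N₀ (fun j => ‖f z j / outer q m z j‖) ≤ 1)
    (hlow : ∀ z ∈ Metric.ball (0 : ℂ) 1, δ ≤ N₀ (fun j => ‖f z j / outer q m z j‖)) :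
    ∃ g : ℂ → ι → ℂ, (∀ j, DifferentiableOn ℂ (fun z => g z j) (Metric.ball 0 ρ)) ∧
      (∀ z ∈ Metric.ball (0 : ℂ) ρ, ∑ j, f z j * g z j = 1) ∧
      ∀ z ∈ Metric.ball (0 : ℂ) ρ, ∀ x : ι → ℝ,
        ∑ j, |x j| * (‖g z j‖ * ‖outer q m z j‖) ≤ C * N₀ x := by
  have hφ : ∀ j, DifferentiableOn ℂ (fun z => f z j / outer q m z j) (Metric.ball 0 1) :=
    fun j => (hf j).fun_div (differentiableOn_outer hq j) fun z _ => outer_ne_zero z j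
  have hsub : Metric.ball (0 : ℂ) ρ ⊆ Metric.ball 0 1 := Metric.ball_subset_ball hρ'.le
  have hup' : ∀ z ∈ Metric.ball (0 : ℂ) ρ, N₀ (fun j => ‖f z j / outer q m z j‖) ≤ 1 := by
    intro z hz
    refine mem_of_mem_sphere (h₀.convex_ball 1) (h₀.isClosed_ball 1)
      (φ := fun z j => f z j / outer q m z j) (fun j => ?_) hup hz
    refine DifferentiableOn.diffContOnCl ((hφ j).mono ?_)
    rw [closure_ball 0 hρ.ne']
    exact Metric.closedBall_subset_ball hρ'
  have hmul : ∀ z ∈ Metric.ball (0 : ℂ) 1, (ρ : ℂ) * z ∈ Metric.ball (0 : ℂ) ρ := by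
    intro z hz
    have : ‖z‖ < 1 := by simpa using hz
    simp only [mem_ball_zero_iff, norm_mul, Complex.norm_real, Real.norm_of_nonneg hρ.le]
    nlinarith
  have hdiv : ∀ z ∈ Metric.ball (0 : ℂ) ρ, z / ρ ∈ Metric.ball (0 : ℂ) 1 := by
    intro z hz
    have : ‖z‖ < ρ := by simpa using hz
    simp only [mem_ball_zero_iff, norm_div, Complex.norm_real, Real.norm_of_nonneg hρ.le]
    rwa [div_lt_one hρ]
  have hρc : (ρ : ℂ) ≠ 0 := by exact_mod_cast hρ.ne'
  obtain ⟨g, hgd, hg1, hgC⟩ := hcor (fun z j => f (ρ * z) j / outer q m (ρ * z) j)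
    (fun j => (hφ j).comp (f := fun z : ℂ => (ρ : ℂ) * z) (by fun_prop)
      fun z hz => hsub (hmul z hz))
    (fun z hz => ⟨hlow _ (hsub (hmul z hz)), hup' _ (hmul z hz)⟩)
  refine ⟨fun z j => g (z / ρ) j / outer q m z j, fun j => ?_, fun z hz => ?_, fun z hz x => ?_⟩
  · refine DifferentiableOn.fun_div ?_ ((differentiableOn_outer hq j).mono hsub)
      fun z _ => outer_ne_zero z j
    exact (hgd j).comp (f := fun z : ℂ => z / (ρ : ℂ)) (by fun_prop) hdiv
  · rw [← hg1 _ (hdiv z hz)]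
    refine Finset.sum_congr rfl fun j _ => ?_
    rw [mul_div_cancel₀ z hρc]
    ring
  · refine le_trans (le_of_eq ?_) (hgC _ (hdiv z hz) x)
    refine Finset.sum_congr rfl fun j _ => ?_
    rw [norm_div, div_mul_cancel₀ _ (norm_outer_pos z j).ne']

lemma continuousOn_norm_comp_mul {g : ℂ → ι → ℂ} {s ρ : ℝ} (hs : 0 < s) (hsρ : s < ρ)
    (hg : ∀ j, DifferentiableOn ℂ (fun z => g z j) (Metric.ball 0 ρ)) (j : ι) :
    ContinuousOn (fun ξ : ℂ => ‖g (s * ξ) j‖) (Metric.sphere 0 1) := by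
  refine ((hg j).continuousOn.comp (f := fun ξ : ℂ => (s : ℂ) * ξ) (by fun_prop) ?_).norm
  intro ξ hξ
  have : ‖ξ‖ = 1 := by simpa using hξ
  simp [this, abs_of_pos hs, hsρ]

/-- Here x b is the factorization of a weight on the cell. Since |b| ≤ m k is nearly at most |ψ|
there, |x b g| is nearly at most |x| |g| |ψ|, whose sum is controlled by the first lattice. Averages
are taken at radius `s < ρ` because g is analytic only in the open disk of radius `ρ`. -/
lemma sum_mul_avg_le [Fintype ι] {N₀ : (ι → ℝ) → ℝ} {C : ℝ}
    (hq : IsCirclePartition q d) {m : κ → ι → ℝ} (hm : ∀ k j, 0 < m k j) {L : ℝ} (hL0 : 0 ≤ L)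
    (hL : ∀ k j, |Real.log (m k j)| ≤ L) {s ρ : ℝ} (hs : 0 < s) (hsρ : s < ρ) (hρ' : ρ < 1)
    {g : ℂ → ι → ℂ} (hg : ∀ j, DifferentiableOn ℂ (fun z => g z j) (Metric.ball 0 ρ))
    (hgC : ∀ z ∈ Metric.ball (0 : ℂ) ρ, ∀ x : ι → ℝ,
        ∑ j, |x j| * (‖g z j‖ * ‖outer q m z j‖) ≤ C * N₀ x)
    {k : κ} {x b : ι → ℝ} (hb : ∀ j, |b j| ≤ m k j) :
    ∑ j, |x j * b j| * avg (fun ξ => ‖g (s * ξ) j‖ * cellInd q k ξ) ≤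
      C * N₀ x * (avg (cellInd q k) + (Real.exp (2 * L) - 1) *
        avg (fun ξ => (1 - cellPoisson q k (s * ξ)) * cellInd q k ξ)) := by
  have hcont := continuousOn_norm_comp_mul hs hsρ hg
  have hball : ∀ ξ : ℂ, ‖ξ‖ = 1 → (s : ℂ) * ξ ∈ Metric.ball (0 : ℂ) ρ := by
    intro ξ hξ
    simp [hξ, abs_of_pos hs, hsρ]
  have hball1 : ∀ ξ : ℂ, ‖ξ‖ = 1 → (s : ℂ) * ξ ∈ Metric.ball (0 : ℂ) 1 := fun ξ hξ =>
    Metric.ball_subset_ball hρ'.le (hball ξ hξ)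
  have hpc : ContinuousOn (fun ξ : ℂ => 1 - cellPoisson q k (s * ξ)) (Metric.sphere 0 1) := by
    refine continuousOn_const.sub ((continuousOn_cellPoisson hq k).comp
      (f := fun ξ : ℂ => (s : ℂ) * ξ) (by fun_prop) fun ξ hξ => hball1 ξ (by simpa using hξ))
  have hI := circleIntegrable_cellInd hq k
  have hI2 := circleIntegrable_mul_cellInd hq hpc k
  have hI3 : ∀ j, CircleIntegrable
      (fun ξ => |x j * b j| * (‖g (s * ξ) j‖ * cellInd q k ξ)) 0 1 := fun j =>
    CircleIntegrable.const_mul' _ (circleIntegrable_mul_cellInd hq (hcont j) k)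
  set M := Real.exp (2 * L) - 1 with hM
  have hM0 : 0 ≤ M := by
    have := Real.add_one_le_exp (2 * L)
    rw [hM]; linarith
  have e1 : ∑ j, |x j * b j| * avg (fun ξ => ‖g (s * ξ) j‖ * cellInd q k ξ) =
      avg (fun ξ => ∑ j, |x j * b j| * (‖g (s * ξ) j‖ * cellInd q k ξ)) := by
    rw [avg, Real.circleAverage_fun_sum fun j _ => hI3 j]
    exact Finset.sum_congr rfl fun j _ => (avg_const_mul _ _).symm
  have e2 : C * N₀ x * (avg (cellInd q k) + M *
        avg (fun ξ => (1 - cellPoisson q k (s * ξ)) * cellInd q k ξ)) =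
      avg (fun ξ => C * N₀ x * (cellInd q k ξ +
        M * ((1 - cellPoisson q k (s * ξ)) * cellInd q k ξ))) := by
    rw [avg_const_mul, ← avg_const_mul M, avg, avg, avg,
      ← Real.circleAverage_fun_add hI (CircleIntegrable.const_mul' M hI2)]
  rw [e1, e2]
  have hIs : CircleIntegrable
      (fun ξ => ∑ j, |x j * b j| * (‖g (s * ξ) j‖ * cellInd q k ξ)) 0 1 := by
    have := CircleIntegrable.sum Finset.univ (c := 0) (R := 1)
      (f := fun j ξ => |x j * b j| * (‖g (s * ξ) j‖ * cellInd q k ξ)) fun j _ => hI3 j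
    convert! this using 1
    ext ξ
    simp
  refine avg_mono hIs (CircleIntegrable.const_mul' _
    (hI.fun_add (CircleIntegrable.const_mul' M hI2))) fun ξ hξ => ?_
  have hz := hball ξ hξ
  have hz1 := hball1 ξ hξ
  have hind := cellInd_nonneg (q := q) k ξ
  have hp1 : 0 ≤ 1 + M * (1 - cellPoisson q k (s * ξ)) := by
    have := sub_nonneg.2 (cellPoisson_le_one hq hz1 k)
    positivity
  calc ∑ j, |x j * b j| * (‖g (s * ξ) j‖ * cellInd q k ξ)
      ≤ ∑ j, |x j| * (‖g (s * ξ) j‖ * ‖outer q m (s * ξ) j‖) *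
          (1 + M * (1 - cellPoisson q k (s * ξ))) * cellInd q k ξ := by
        refine Finset.sum_le_sum fun j _ => ?_
        have h1 : |b j| ≤ ‖outer q m (s * ξ) j‖ * (1 + M * (1 - cellPoisson q k (s * ξ))) :=
          (hb j).trans (le_norm_outer_mul hq hz1 hm hL k j)
        rw [abs_mul]
        calc |x j| * |b j| * (‖g (s * ξ) j‖ * cellInd q k ξ)
            = |x j| * ‖g (s * ξ) j‖ * cellInd q k ξ * |b j| := by ring
          _ ≤ |x j| * ‖g (s * ξ) j‖ * cellInd q k ξ *
              (‖outer q m (s * ξ) j‖ * (1 + M * (1 - cellPoisson q k (s * ξ)))) :=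
            mul_le_mul_of_nonneg_left h1 (by positivity)
          _ = _ := by ring
    _ = (∑ j, |x j| * (‖g (s * ξ) j‖ * ‖outer q m (s * ξ) j‖)) *
          ((1 + M * (1 - cellPoisson q k (s * ξ))) * cellInd q k ξ) := by
        rw [Finset.sum_mul]
        exact Finset.sum_congr rfl fun j _ => by ring
    _ ≤ C * N₀ x * ((1 + M * (1 - cellPoisson q k (s * ξ))) * cellInd q k ξ) :=
        mul_le_mul_of_nonneg_right (hgC _ hz x) (mul_nonneg hp1 hind)
    _ = _ := by ring

end Solution

/-! ### From weighted averages to pointwise bounds by minimax. -/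

section Minimax

variable {ι κ : Type*} {q : ℂ → κ} {d : ℝ}

/-- The sum ∑ |c j| |g j| is dominated at z by its Poisson average over the circle of radius `s`,
and the kernel is nearly constant on the cells. -/
lemma sum_norm_le_of_cell_averages [Fintype ι] [Fintype κ] [DecidableEq κ] (hd : 0 ≤ d) (hq : IsCirclePartition q d)
    {N : (ι → ℝ) → ℝ} (hN : IsLatticeNorm N) {s ρ : ℝ} (hs : 0 < s) (hsρ : s < ρ)
    {g : ℂ → ι → ℂ} (hg : ∀ j, DifferentiableOn ℂ (fun z => g z j) (Metric.ball 0 ρ))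
    {D : ℝ} (hD : 0 ≤ D)
    (hgD : ∀ k, ∀ c : ι → ℝ, (∀ j, 0 ≤ c j) →
      ∑ j, c j * avg (fun ξ => ‖g (s * ξ) j‖ * cellInd q k ξ) ≤ D * N c * avg (cellInd q k))
    {r r' : ℝ} (hr' : r' < 1) (hrs : r ≤ s * r') {z : ℂ} (hz : z ∈ Metric.ball (0 : ℂ) r)
    (c : ι → ℝ) :
    ∑ j, |c j| * ‖g z j‖ ≤ D * (1 + 8 / (1 - r') ^ 4 * d) * N c := by
  have hzr : ‖z‖ < r := by simpa using hz
  have hsc : (s : ℂ) ≠ 0 := by exact_mod_cast hs.ne'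
  -- The phases are frozen at the given point z. The resulting linear combination of the g j is
  -- analytic, equals the sum of moduli at z and is dominated by it elsewhere.
  set u : ι → ℂ := fun j => if g z j = 0 then 0 else (‖g z j‖ : ℂ) / g z j with hu
  have hu1 : ∀ j, ‖u j‖ ≤ 1 := by
    intro j
    simp only [hu]
    split_ifs with h
    · simp
    · rw [norm_div, Complex.norm_real, norm_norm, div_self (norm_ne_zero_iff.2 h)]
  have hug : ∀ j, u j * g z j = (‖g z j‖ : ℂ) := by
    intro j
    simp only [hu]
    split_ifs with h
    · simp [h]
    · exact div_mul_cancel₀ _ h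
  have hmaps : Set.MapsTo (fun w : ℂ => (s : ℂ) * w) (Metric.closedBall 0 1)
      (Metric.ball 0 ρ) := by
    intro w hw
    have : ‖w‖ ≤ 1 := by simpa using hw
    simp only [mem_ball_zero_iff, norm_mul, Complex.norm_real, Real.norm_of_nonneg hs.le]
    nlinarith
  set F : ℂ → ℂ := fun w => ∑ j, ((|c j| : ℝ) : ℂ) * (u j * g (s * w) j) with hF
  have hFd : DiffContOnCl ℂ F (Metric.ball 0 1) := by
    refine DifferentiableOn.diffContOnCl ?_
    rw [closure_ball 0 one_ne_zero]
    refine DifferentiableOn.fun_sum fun j _ => DifferentiableOn.const_mul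
      (DifferentiableOn.const_mul ?_ _) _
    exact (hg j).comp (f := fun w : ℂ => (s : ℂ) * w) (by fun_prop) hmaps
  have hcont := continuousOn_norm_comp_mul hs hsρ hg
  have hXc : ContinuousOn (fun ξ : ℂ => ∑ j, |c j| * ‖g (s * ξ) j‖) (Metric.sphere 0 1) :=
    continuousOn_finsetSum _ fun j _ => continuousOn_const.mul (hcont j)
  have hws : ‖z / s‖ ≤ r' := by
    rw [norm_div, Complex.norm_real, Real.norm_of_nonneg hs.le, div_le_iff₀ hs]
    linarith
  have hwb : z / s ∈ Metric.ball (0 : ℂ) 1 := by simpa using hws.trans_lt hr'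
  have h1 := re_le_avg_poissonKernel_mul hFd hXc (fun ξ _ => by
    refine (Complex.re_le_norm _).trans ((norm_sum_le _ _).trans (Finset.sum_le_sum fun j _ => ?_))
    rw [norm_mul, norm_mul, Complex.norm_real, norm_abs_eq_norm, Real.norm_eq_abs]
    refine mul_le_mul_of_nonneg_left ?_ (abs_nonneg _)
    exact mul_le_of_le_one_left (norm_nonneg _) (hu1 j)) hwb
  have hFz : (F (z / s)).re = ∑ j, |c j| * ‖g z j‖ := by
    simp only [hF]
    rw [mul_div_cancel₀ z hsc]
    simp only [hug]
    rw [Complex.re_sum]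
    refine Finset.sum_congr rfl fun j _ => ?_
    rw [← Complex.ofReal_mul, Complex.ofReal_re]
  have h2 := avg_poissonKernel_mul_le hd hq hXc
    (fun ξ _ => Finset.sum_nonneg fun j _ => mul_nonneg (abs_nonneg _) (norm_nonneg _))
    (mul_nonneg hD (hN.nonneg c)) (fun k => by
      have h3 := hgD k (fun j => |c j|) fun j => abs_nonneg _
      rw [hN.abs_eq] at h3
      refine le_trans (le_of_eq ?_) h3
      have h4 : (fun ξ : ℂ => (∑ j, |c j| * ‖g (s * ξ) j‖) * cellInd q k ξ) =
          fun ξ => ∑ j, |c j| * (‖g (s * ξ) j‖ * cellInd q k ξ) := by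
        ext ξ
        rw [Finset.sum_mul]
        exact Finset.sum_congr rfl fun j _ => by ring
      rw [h4, avg, Real.circleAverage_fun_sum fun j _ => CircleIntegrable.const_mul' _
        (circleIntegrable_mul_cellInd hq (hcont j) k)]
      exact Finset.sum_congr rfl fun j _ => avg_const_mul _ _) hr' hws
  rw [← hFz]
  refine h1.trans (h2.trans (le_of_eq ?_))
  ring

/-- Null cells are invisible to normalised averages, since Lean's division by zero gives 0; they are
settled separately by this lemma. -/
lemma avg_mul_cellInd_eq_zero [DecidableEq κ] (hq : IsCirclePartition q d) {X : ℂ → ℝ}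
    (hX : ContinuousOn X (Metric.sphere 0 1)) (hX0 : ∀ ξ, 0 ≤ X ξ) {k : κ}
    (hk : avg (cellInd q k) = 0) : avg (fun ξ => X ξ * cellInd q k ξ) = 0 := by
  obtain ⟨B, hB⟩ := (isCompact_sphere (0 : ℂ) 1).exists_bound_of_continuousOn hX
  refine le_antisymm ?_ (avg_nonneg fun ξ _ => mul_nonneg (hX0 ξ) (cellInd_nonneg k ξ))
  calc avg (fun ξ => X ξ * cellInd q k ξ) ≤ avg (fun ξ => B * cellInd q k ξ) := by
        refine avg_mono (circleIntegrable_mul_cellInd hq hX k)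
          (CircleIntegrable.const_mul' _ (circleIntegrable_cellInd hq k)) fun ξ hξ => ?_
        exact mul_le_mul_of_nonneg_right ((le_abs_self _).trans (hB ξ (by simpa using hξ)))
          (cellInd_nonneg k ξ)
    _ = 0 := by rw [avg_const_mul, hk, mul_zero]

lemma isCompact_sum_latticeNorm_le [Fintype ι] [Fintype κ] {N : (ι → ℝ) → ℝ} (hN : IsLatticeNorm N) :
    IsCompact {h : κ × ι → ℝ | (∀ p, 0 ≤ h p) ∧ ∑ k, N (fun j => h (k, j)) ≤ 1} := by
  refine Metric.isCompact_of_isClosed_isBounded ?_ ?_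
  · have h1 : IsClosed {h : κ × ι → ℝ | ∀ p, 0 ≤ h p} := isClosed_le continuous_const continuous_id
    have h2 : Continuous fun h : κ × ι → ℝ => ∑ k, N fun j => h (k, j) :=
      continuous_finsetSum _ fun k _ => hN.continuous.comp (by fun_prop)
    exact h1.inter (isClosed_le h2 continuous_const)
  · obtain ⟨B, hB, hNB⟩ := hN.exists_abs_le
    refine (Metric.isBounded_closedBall (x := (0 : κ × ι → ℝ)) (r := B)).subset fun h hh => ?_
    rw [mem_closedBall_zero_iff, pi_norm_le_iff_of_nonneg hB.le]
    rintro ⟨k, j⟩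
    refine (hNB (fun j => h (k, j)) j).trans (mul_le_of_le_one_right hB.le (le_trans ?_ hh.2))
    exact Finset.single_le_sum (f := fun k => N fun j => h (k, j)) (fun k _ => hN.nonneg _)
      (Finset.mem_univ k)

lemma convex_sum_latticeNorm_le [Fintype κ] {N : (ι → ℝ) → ℝ} (hN : IsLatticeNorm N) :
    Convex ℝ {h : κ × ι → ℝ | (∀ p, 0 ≤ h p) ∧ ∑ k, N (fun j => h (k, j)) ≤ 1} := by
  rintro x ⟨hx0, hx⟩ y ⟨hy0, hy⟩ a b ha hb hab
  refine ⟨fun p => add_nonneg (mul_nonneg ha (hx0 p)) (mul_nonneg hb (hy0 p)), ?_⟩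
  calc ∑ k, N (fun j => (a • x + b • y) (k, j))
      ≤ ∑ k, (a * N (fun j => x (k, j)) + b * N (fun j => y (k, j))) := by
        refine Finset.sum_le_sum fun k _ => ?_
        rw [← hN.smul_nonneg ha, ← hN.smul_nonneg hb]
        exact hN.add_le _ _
    _ = a * ∑ k, N (fun j => x (k, j)) + b * ∑ k, N (fun j => y (k, j)) := by
        rw [Finset.sum_add_distrib, Finset.mul_sum, Finset.mul_sum]
    _ ≤ a * 1 + b * 1 := by gcongr
    _ = 1 := by rw [mul_one, mul_one, hab]

/-- If for every weight `h` some solution `g` of `∑ f g = 1` has small weighted averages, then some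
solution has small averages for all weights at once. -/
lemma exists_solution_cell_averages_le [Fintype ι] [Fintype κ] [DecidableEq κ]
    (hq : IsCirclePartition q d) {N : (ι → ℝ) → ℝ} (hN : IsLatticeNorm N) {f : ℂ → ι → ℂ} {s ρ : ℝ} (hs : 0 < s) (hsρ : s < ρ) {D D' : ℝ}
    (hDD : D < D')
    (H : ∀ h : κ × ι → ℝ, (∀ p, 0 ≤ h p) → ∑ k, N (fun j => h (k, j)) ≤ 1 →
      ∃ g : ℂ → ι → ℂ, (∀ j, DifferentiableOn ℂ (fun z => g z j) (Metric.ball 0 ρ)) ∧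
        (∀ z ∈ Metric.ball (0 : ℂ) ρ, ∑ j, f z j * g z j = 1) ∧
        ∑ k, ∑ j, h (k, j) * (avg (fun ξ => ‖g (s * ξ) j‖ * cellInd q k ξ) / avg (cellInd q k))
          ≤ D) :
    ∃ g : ℂ → ι → ℂ, (∀ j, DifferentiableOn ℂ (fun z => g z j) (Metric.ball 0 ρ)) ∧
      (∀ z ∈ Metric.ball (0 : ℂ) ρ, ∑ j, f z j * g z j = 1) ∧
      ∀ k, ∀ c : ι → ℝ, (∀ j, 0 ≤ c j) →
        ∑ j, c j * avg (fun ξ => ‖g (s * ξ) j‖ * cellInd q k ξ) ≤ D' * N c * avg (cellInd q k) := by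
  set μ := fun k => avg (cellInd q k) with hμ
  have hμ0 : ∀ k, 0 ≤ μ k := fun k => avg_nonneg fun ξ _ => cellInd_nonneg k ξ
  set P : (ℂ → ι → ℂ) → Prop := fun g =>
    (∀ j, DifferentiableOn ℂ (fun z => g z j) (Metric.ball 0 ρ)) ∧
      ∀ z ∈ Metric.ball (0 : ℂ) ρ, ∑ j, f z j * g z j = 1 with hP
  set A : (ℂ → ι → ℂ) → κ × ι → ℝ := fun g p =>
    avg (fun ξ => ‖g (s * ξ) p.2‖ * cellInd q p.1 ξ) / μ p.1 with hA
  have hint : ∀ g, P g → ∀ k j, CircleIntegrable (fun ξ => ‖g (s * ξ) j‖ * cellInd q k ξ) 0 1 :=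
    fun g hg k j => circleIntegrable_mul_cellInd hq (continuousOn_norm_comp_mul hs hsρ hg.1 j) k
  -- The averages of |g| are only convex in g, so the upper closure of their range is used. It is
  -- convex because solutions of the affine equation ∑ f g = 1 are.
  have hconv : Convex ℝ {a : κ × ι → ℝ | ∃ g, P g ∧ ∀ p, A g p ≤ a p} := by
    rintro a ⟨g, hg, hga⟩ a' ⟨g', hg', hga'⟩ t t' ht ht' htt
    have hPg : P fun z j => (t : ℂ) * g z j + (t' : ℂ) * g' z j := by
      refine ⟨fun j => ((hg.1 j).const_mul _).add ((hg'.1 j).const_mul _), fun z hz => ?_⟩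
      calc ∑ j, f z j * ((t : ℂ) * g z j + (t' : ℂ) * g' z j)
          = (t : ℂ) * ∑ j, f z j * g z j + (t' : ℂ) * ∑ j, f z j * g' z j := by
            rw [Finset.mul_sum, Finset.mul_sum, ← Finset.sum_add_distrib]
            exact Finset.sum_congr rfl fun j _ => by ring
        _ = 1 := by
            rw [hg.2 z hz, hg'.2 z hz, mul_one, mul_one, ← Complex.ofReal_add, htt,
              Complex.ofReal_one]
    refine ⟨_, hPg, fun p => ?_⟩
    have h1 : avg (fun ξ => ‖(t : ℂ) * g (s * ξ) p.2 + (t' : ℂ) * g' (s * ξ) p.2‖ *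
          cellInd q p.1 ξ) ≤ t * avg (fun ξ => ‖g (s * ξ) p.2‖ * cellInd q p.1 ξ) +
          t' * avg (fun ξ => ‖g' (s * ξ) p.2‖ * cellInd q p.1 ξ) := by
      rw [← avg_const_mul, ← avg_const_mul, avg, avg, avg, ← Real.circleAverage_fun_add
        (CircleIntegrable.const_mul' _ (hint g hg _ _))
        (CircleIntegrable.const_mul' _ (hint g' hg' _ _))]
      refine avg_mono (hint _ hPg _ _) ((CircleIntegrable.const_mul' _ (hint g hg _ _)).fun_add
        (CircleIntegrable.const_mul' _ (hint g' hg' _ _))) fun ξ _ => ?_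
      rw [← mul_assoc, ← mul_assoc, ← add_mul]
      refine mul_le_mul_of_nonneg_right ((norm_add_le _ _).trans (le_of_eq ?_))
        (cellInd_nonneg _ _)
      rw [norm_mul, norm_mul, Complex.norm_real, Complex.norm_real, Real.norm_of_nonneg ht,
        Real.norm_of_nonneg ht']
    calc _ ≤ (t * avg (fun ξ => ‖g (s * ξ) p.2‖ * cellInd q p.1 ξ) +
          t' * avg (fun ξ => ‖g' (s * ξ) p.2‖ * cellInd q p.1 ξ)) / μ p.1 :=
          div_le_div_of_nonneg_right h1 (hμ0 _)
      _ = t * A g p + t' * A g' p := by simp only [hA]; ring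
      _ ≤ t * a p + t' * a' p := add_le_add (mul_le_mul_of_nonneg_left (hga p) ht)
          (mul_le_mul_of_nonneg_left (hga' p) ht')
  obtain ⟨a, ⟨g, hg, hga⟩, hlt⟩ := exists_forall_sum_mul_lt
    (H := {h : κ × ι → ℝ | (∀ p, 0 ≤ h p) ∧ ∑ k, N (fun j => h (k, j)) ≤ 1})
    ⟨0, fun _ => le_rfl, by
      have : N (fun _ => 0) = 0 := hN.map_zero
      simp [this]⟩
    (isCompact_sum_latticeNorm_le hN) (convex_sum_latticeNorm_le hN) hconv hDD
    (fun h hh => by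
      obtain ⟨g, hg1, hg2, hg3⟩ := H h hh.1 hh.2
      refine ⟨A g, ⟨g, ⟨hg1, hg2⟩, fun _ => le_rfl⟩, ?_⟩
      rw [Fintype.sum_prod_type]
      exact hg3)
  refine ⟨g, hg.1, hg.2, fun k c hc => ?_⟩
  by_cases hk : μ k = 0
  · have : ∀ j, avg (fun ξ => ‖g (s * ξ) j‖ * cellInd q k ξ) = 0 := fun j =>
      avg_mul_cellInd_eq_zero hq (continuousOn_norm_comp_mul hs hsρ hg.1 j)
        (fun _ => norm_nonneg _) hk
    simp only [this, mul_zero, Finset.sum_const_zero]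
    rw [show avg (cellInd q k) = 0 from hk, mul_zero]
  have hμk : 0 < μ k := lt_of_le_of_ne (hμ0 k) (Ne.symm hk)
  rcases (hN.nonneg c).eq_or_lt with h0 | hpos
  · have : c = 0 := hN.eq_zero c h0.symm
    simp [this, hN.map_zero]
  -- The test weight is c, normalised in `N` and placed on the single cell k.
  have h5 := hlt (fun p => if p.1 = k then (N c)⁻¹ * c p.2 else 0) ⟨fun p => by
      simp only
      split_ifs
      · exact mul_nonneg (inv_nonneg.2 hpos.le) (hc _)
      · exact le_rfl, by
      have h6 : ∀ k', N (fun j => if k' = k then (N c)⁻¹ * c j else 0) = if k' = k then 1 else 0 := by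
        intro k'
        split_ifs
        · have := hN.smul_nonneg (inv_nonneg.2 hpos.le) c
          rw [inv_mul_cancel₀ hpos.ne'] at this
          exact this
        · exact hN.map_zero
      simp [h6]⟩
  rw [Fintype.sum_prod_type, Finset.sum_eq_single k (fun k' _ hk' => by simp [hk']) (by simp)] at h5
  simp only [if_true] at h5
  have h7 : ∑ j, (N c)⁻¹ * c j * A g (k, j) ≤ D' := by
    refine (Finset.sum_le_sum fun j _ => ?_).trans h5.le
    exact mul_le_mul_of_nonneg_left (hga _) (mul_nonneg (inv_nonneg.2 hpos.le) (hc _))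
  have h8 : ∑ j, (N c)⁻¹ * c j * A g (k, j) =
      (∑ j, c j * avg (fun ξ => ‖g (s * ξ) j‖ * cellInd q k ξ)) / (N c * μ k) := by
    rw [Finset.sum_div]
    refine Finset.sum_congr rfl fun j _ => ?_
    simp only [hA]
    field_simp
  rw [h8, div_le_iff₀ (by positivity)] at h7
  rw [mul_assoc]
  exact h7

end Minimax

/-! ### The corona theorem for finitely many coordinates. -/

section FiniteSolution

variable {ι : Type*}

/-- Weighted estimate for one solution adapted to the weight `h`. -/
lemma exists_solution_weighted_average_le [Fintype ι] {κ : Type*} [Fintype κ] [DecidableEq κ]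
    {q : ℂ → κ} {d : ℝ} {N₀ N₁ N : (ι → ℝ) → ℝ} (h₀ : IsLatticeNorm N₀)
    (h₁ : IsLatticeNorm N₁) (hN : IsLatticeNorm N) (hmul : ∀ x y, N (x * y) ≤ N₀ x * N₁ y)
    (hfac : HasFactorization N₀ N₁ N) {δ C θ : ℝ} (hC : 0 ≤ C) (hcor : HasFiniteCorona N₀ δ C)
    (hθ' : θ < 1 / 6) (hq : IsCirclePartition q d)
    {f : ℂ → ι → ℂ} (hf : ∀ j, DifferentiableOn ℂ (fun z => f z j) (Metric.ball 0 1))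
    (hlow : ∀ z ∈ Metric.ball (0 : ℂ) 1, δ * (2 - 3 * θ) ≤ N (fun j => ‖f z j‖))
    {a : κ → ι → ℝ} (ha0 : ∀ k j, 0 < a k j) (ha1 : ∀ k, N₁ (a k) ≤ 1 + 3 * θ) {L t s ρ : ℝ}
    (hs : 0 < s) (hsρ : s < ρ) (hρ' : ρ < 1) (ht : 0 < t) (hL0 : 0 ≤ L)
    (hL : ∀ m : κ → ι → ℝ, (∀ k j, a k j ≤ m k j) → (∀ k, N₁ (m k) ≤ 2 - 3 * θ) →
      ∀ k j, |Real.log (m k j)| ≤ L)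
    (hup : ∀ m : κ → ι → ℝ, (∀ k j, a k j ≤ m k j) → ∀ z ∈ Metric.sphere (0 : ℂ) ρ,
      N₀ (fun j => ‖f z j / outer q m z j‖) ≤ 1)
    (hst : ∀ k, 0 < avg (cellInd q k) → (Real.exp (2 * L) - 1) *
      avg (fun ξ => (1 - cellPoisson q k (s * ξ)) * cellInd q k ξ) ≤ t * avg (cellInd q k))
    {h : κ × ι → ℝ} (hh0 : ∀ p, 0 ≤ h p) (hh1 : ∑ k, N (fun j => h (k, j)) ≤ 1) :
    ∃ g : ℂ → ι → ℂ, (∀ j, DifferentiableOn ℂ (fun z => g z j) (Metric.ball 0 ρ)) ∧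
      (∀ z ∈ Metric.ball (0 : ℂ) ρ, ∑ j, f z j * g z j = 1) ∧
      ∑ k, ∑ j, h (k, j) * (avg (fun ξ => ‖g (s * ξ) j‖ * cellInd q k ξ) / avg (cellInd q k))
        ≤ C * (1 + t) ^ 2 / (1 - 6 * θ) := by
  -- This radius for the second factor is chosen so that (1 + 3θ) + β = 2 - 3θ, the bound for `N₁
  -- m`.
  set β := 1 - 6 * θ with hβd
  have hβ : 0 < β := by linarith
  -- The slack makes the factorization inequality strict, even on cells where h vanishes, and adds
  -- up to at most `t` over all cells.
  set ε := t / (Fintype.card κ + 1) with hεd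
  have hε : 0 < ε := by positivity
  have hNh : ∀ k, 0 ≤ N (fun j => h (k, j)) := fun k => hN.nonneg _
  have hfac' : ∀ k, ∃ y w : ι → ℝ, (fun j => h (k, j)) = y * w ∧
      N₀ y ≤ ((N fun j => h (k, j)) + ε) / β ∧ N₁ w ≤ β := by
    intro k
    refine hfac _ _ _ (div_pos (by linarith [hNh k]) hβ) hβ ?_
    rw [div_mul_cancel₀ _ hβ.ne']
    linarith
  choose y w hyw hy hw using hfac'
  -- The modulus must dominate a, for the upper bound of f/ψ, and |w|, for the estimate against the
  -- weight.
  set m : κ → ι → ℝ := fun k j => max (a k j) |w k j| with hm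
  have ham : ∀ k j, a k j ≤ m k j := fun k j => le_max_left _ _
  have hm0 : ∀ k j, 0 < m k j := fun k j => (ha0 k j).trans_le (ham k j)
  have hm1 : ∀ k, N₁ (m k) ≤ 2 - 3 * θ := by
    intro k
    have h2 : N₁ (m k) ≤ N₁ (a k + fun j => |w k j|) := by
      refine h₁.mono _ _ fun j => ?_
      have : 0 ≤ a k j + |w k j| := add_nonneg (ha0 k j).le (abs_nonneg _)
      simp only [Pi.add_apply]
      rw [abs_of_pos (hm0 k j), abs_of_nonneg this]
      exact max_le (by linarith [abs_nonneg (w k j)]) (by linarith [ha0 k j])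
    have h3 := h₁.add_le (a k) fun j => |w k j|
    rw [h₁.abs_eq] at h3
    linarith [ha1 k, hw k]
  have hθ2 : 0 < 2 - 3 * θ := by linarith
  obtain ⟨g, hgd, hg1, hgC⟩ := exists_solution_div_outer h₀ hcor hq (m := m) (hs.trans hsρ) hρ' hf
    (hup m ham) (fun z hz => by
      have h4 : N (fun j => ‖f z j‖) ≤ N₀ (fun j => ‖f z j / outer q m z j‖) *
          N₁ (fun j => ‖outer q m z j‖) := by
        refine le_trans (le_of_eq ?_) (hmul _ _)
        congr 1
        ext j
        rw [Pi.mul_apply, norm_div, div_mul_cancel₀ _ (norm_outer_pos z j).ne']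
      have h5 := latticeNorm_outer_le hq hz h₁ hm0 hm1
      have h6 := (hlow z hz).trans (h4.trans (mul_le_mul_of_nonneg_left h5 (h₀.nonneg _)))
      exact le_of_mul_le_mul_right h6 hθ2)
  refine ⟨g, hgd, hg1, ?_⟩
  have hμ0 : ∀ k, 0 ≤ avg (cellInd q k) := fun k => avg_nonneg fun ξ _ => cellInd_nonneg k ξ
  have hk : ∀ k, ∑ j, h (k, j) * (avg (fun ξ => ‖g (s * ξ) j‖ * cellInd q k ξ) /
      avg (cellInd q k)) ≤ C * (((N fun j => h (k, j)) + ε) / β) * (1 + t) := by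
    intro k
    have hR : 0 ≤ C * (((N fun j => h (k, j)) + ε) / β) * (1 + t) :=
      mul_nonneg (mul_nonneg hC (div_nonneg (add_nonneg (hNh k) hε.le) hβ.le)) (by linarith)
    rcases (hμ0 k).eq_or_lt with h0 | hpos
    · simpa [← h0] using hR
    have h7 := sum_mul_avg_le hq hm0 hL0 (hL m ham hm1) hs hsρ hρ' hgd hgC (k := k) (x := y k)
      (b := w k) fun j => le_max_right _ _
    have h8 : ∀ j, |y k j * w k j| = h (k, j) := fun j => by
      rw [← abs_of_nonneg (hh0 (k, j))]
      exact congrArg abs (congrFun (hyw k) j).symm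
    simp only [h8] at h7
    have h9 : ∑ j, h (k, j) * (avg (fun ξ => ‖g (s * ξ) j‖ * cellInd q k ξ) /
        avg (cellInd q k)) = (∑ j, h (k, j) * avg (fun ξ => ‖g (s * ξ) j‖ * cellInd q k ξ)) /
        avg (cellInd q k) := by
      rw [Finset.sum_div]
      exact Finset.sum_congr rfl fun j _ => by ring
    rw [h9, div_le_iff₀ hpos]
    refine h7.trans ?_
    calc _ ≤ C * N₀ (y k) * (avg (cellInd q k) + t * avg (cellInd q k)) :=
          mul_le_mul_of_nonneg_left (by linarith [hst k hpos]) (mul_nonneg hC (h₀.nonneg _))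
      _ ≤ C * (((N fun j => h (k, j)) + ε) / β) *
          (avg (cellInd q k) + t * avg (cellInd q k)) :=
          mul_le_mul_of_nonneg_right (mul_le_mul_of_nonneg_left (hy k) hC) (by positivity)
      _ = _ := by ring
  calc _ ≤ ∑ k, C * (((N fun j => h (k, j)) + ε) / β) * (1 + t) :=
        Finset.sum_le_sum fun k _ => hk k
    _ = C * ((∑ k, N (fun j => h (k, j)) + Fintype.card κ * ε) / β) * (1 + t) := by
        rw [← Finset.sum_mul, ← Finset.mul_sum, ← Finset.sum_div, Finset.sum_add_distrib]
        simp
    _ ≤ C * ((1 + t) / β) * (1 + t) := by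
        have h10 : Fintype.card κ * ε ≤ t := by
          rw [hεd, mul_div_assoc', div_le_iff₀ (by positivity)]
          nlinarith
        gcongr
    _ = C * (1 + t) ^ 2 / β := by ring

lemma abs_log_le_of_mem_Icc {x a b : ℝ} (ha : 0 < a) (hax : a ≤ x) (hxb : x ≤ b) :
    |Real.log x| ≤ |Real.log a| + |Real.log b| := by
  have h1 := Real.log_le_log ha hax
  have h2 := Real.log_le_log (ha.trans_le hax) hxb
  rw [abs_le]
  constructor
  · linarith [neg_abs_le (Real.log a), abs_nonneg (Real.log b)]
  · linarith [le_abs_self (Real.log b), abs_nonneg (Real.log a)]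

/-- The corona property passes from `N₀` to the product lattice `N`, for data analytic in a
neighbourhood of the closed disk, with a small loss in the constants and in the domain. -/
theorem exists_solution_of_hasFiniteCorona [Fintype ι] {N₀ N₁ N : (ι → ℝ) → ℝ}
    (h₀ : IsLatticeNorm N₀) (h₁ : IsLatticeNorm N₁) (hN : IsLatticeNorm N)
    (hmul : ∀ x y, N (x * y) ≤ N₀ x * N₁ y)
    (hfac : HasFactorization N₀ N₁ N) {δ C θ : ℝ} (hC : 0 ≤ C) (hcor : HasFiniteCorona N₀ δ C)
    (hθ : 0 < θ) (hθ' : θ < 1 / 6) {f : ℂ → ι → ℂ} {R : ℝ} (hR : 1 < R)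
    (hf : ∀ j, DifferentiableOn ℂ (fun z => f z j) (Metric.ball 0 R))
    (hup : ∀ z ∈ Metric.sphere (0 : ℂ) 1, N (fun j => ‖f z j‖) ≤ 1)
    (hlow : ∀ z ∈ Metric.ball (0 : ℂ) 1, δ * (2 - 3 * θ) ≤ N (fun j => ‖f z j‖))
    {D : ℝ} (hD : C / (1 - 6 * θ) < D) {r : ℝ} (hr0 : 0 < r) (hr : r < 1) :
    ∃ g : ℂ → ι → ℂ, (∀ j, DifferentiableOn ℂ (fun z => g z j) (Metric.ball 0 r)) ∧
      (∀ z ∈ Metric.ball (0 : ℂ) r, ∑ j, f z j * g z j = 1) ∧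
      ∀ z ∈ Metric.ball (0 : ℂ) r, ∀ c : ι → ℝ, ∑ j, |c j| * ‖g z j‖ ≤ D * N c := by
  classical
  have hβ : 0 < 1 - 6 * θ := by linarith
  obtain ⟨Λ, hΛ0, hΛ⟩ := exists_lipschitz_of_differentiableOn hR hf
  obtain ⟨η, hη, hmaj⟩ := exists_majorant_of_factorization h₀ h₁ hfac hθ hθ'
  have hf1 : ∀ j, DifferentiableOn ℂ (fun z => f z j) (Metric.ball 0 1) := fun j =>
    (hf j).mono (Metric.ball_subset_ball hR.le)
  -- choice of the constants
  obtain ⟨D', hD1, hD2⟩ := exists_between hD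
  have hD'0 : 0 < D' := lt_of_le_of_lt (div_nonneg hC hβ.le) hD1
  obtain ⟨t, ht, htD⟩ : ∃ t : ℝ, 0 < t ∧ C * (1 + t) ^ 2 / (1 - 6 * θ) < D' := by
    have hlim : Tendsto (fun t : ℝ => C * (1 + t) ^ 2 / (1 - 6 * θ)) (𝓝[>] 0)
        (𝓝 (C * (1 + 0) ^ 2 / (1 - 6 * θ))) :=
      (Continuous.tendsto (by fun_prop) 0).mono_left nhdsWithin_le_nhds
    obtain ⟨t, h1, h2⟩ := ((hlim.eventually (gt_mem_nhds (by simpa using hD1))).and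
      self_mem_nhdsWithin).exists
    exact ⟨t, h2, h1⟩
  -- The point z/s will lie in the disk of radius `r'`. Fixing it now fixes the Lipschitz constant
  -- of the Poisson kernel before the mesh and `s` are chosen.
  set r' := (1 + r) / 2 with hr'd
  have hr' : r' < 1 := by linarith
  have hrr' : r < r' := by linarith
  set c := N₀ (fun _ => 1) * Λ / η with hc
  have hc0 : 0 ≤ c := div_nonneg (mul_nonneg (h₀.nonneg _) hΛ0) hη.le
  obtain ⟨n, hn, hn1, hn2⟩ : ∃ n : ℕ, 0 < n ∧ D' * (1 + 8 / (1 - r') ^ 4 * (1 / n)) ≤ D ∧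
      c * (1 / n + 1 / n) ≤ θ / 2 := by
    have h0 : Tendsto (fun n : ℕ => (1 : ℝ) / n) atTop (𝓝 0) := tendsto_one_div_atTop_nhds_zero_nat
    have h1 : Tendsto (fun n : ℕ => D' * (1 + 8 / (1 - r') ^ 4 * (1 / n))) atTop
        (𝓝 (D' * (1 + 8 / (1 - r') ^ 4 * 0))) := ((h0.const_mul _).const_add _).const_mul _
    have h2 : Tendsto (fun n : ℕ => c * ((1 : ℝ) / n + 1 / n)) atTop (𝓝 (c * (0 + 0))) :=
      (h0.add h0).const_mul _
    obtain ⟨n, ⟨h3, h4⟩, h5⟩ := (((h1.eventually (gt_mem_nhds (by simpa using hD2))).and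
      (h2.eventually (gt_mem_nhds (show c * (0 + 0) < θ / 2 by simpa using hθ)))).and
      (eventually_gt_atTop 0)).exists
    exact ⟨n, h5, h3.le, h4.le⟩
  have hn' : (0 : ℝ) < 1 / n := by positivity
  obtain ⟨κ, _, q, hq⟩ := exists_circlePartition hn
  -- the majorants of `f` on the cells
  have hcell : ∀ k, ∃ a : ι → ℝ, (∀ j, η ≤ a j) ∧ N₁ a ≤ 1 + 3 * θ ∧
      ∀ ξ : ℂ, ‖ξ‖ = 1 → q ξ = k → ∃ ξ' : ℂ, ‖ξ'‖ = 1 ∧ q ξ' = k ∧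
        N₀ (fun j => ‖f ξ' j‖ / a j) ≤ 1 - θ := by
    intro k
    by_cases hk : ∃ ξ : ℂ, ‖ξ‖ = 1 ∧ q ξ = k
    · obtain ⟨ζ, hζ, hζk⟩ := hk
      obtain ⟨a, ha, ha0, ha1⟩ := hmaj (f ζ) (hup ζ (by simpa using hζ))
      exact ⟨a, ha, ha1, fun ξ _ _ => ⟨ζ, hζ, hζk, ha0⟩⟩
    -- An empty cell still needs an admissible majorant; any point of the circle supplies one.
    · obtain ⟨a, ha, ha0, ha1⟩ := hmaj (f 1) (hup 1 (by simp))
      exact ⟨a, ha, ha1, fun ξ h1 h2 => absurd ⟨ξ, h1, h2⟩ hk⟩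
  choose a ha ha1 haf using hcell
  have ha0 : ∀ k j, 0 < a k j := fun k j => hη.trans_le (ha k j)
  obtain ⟨B, hB, hNB⟩ := h₁.exists_abs_le
  -- This bound depends on `η` and `N₁` only. The radii `s` and `ρ` can therefore be fixed before
  -- the weights enter, as the minimax argument requires.
  set L := |Real.log η| + |Real.log (B * 2)| with hLd
  have hL : ∀ m : κ → ι → ℝ, (∀ k j, a k j ≤ m k j) → (∀ k, N₁ (m k) ≤ 2 - 3 * θ) →
      ∀ k j, |Real.log (m k j)| ≤ L := by
    intro m ham hm1 k j
    refine abs_log_le_of_mem_Icc hη ((ha k j).trans (ham k j)) ?_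
    refine (le_abs_self _).trans ((hNB (m k) j).trans ?_)
    exact mul_le_mul_of_nonneg_left (by linarith [hm1 k]) hB.le
  -- choice of the radii
  obtain ⟨s, hs0, hs1, hrs, hst⟩ : ∃ s : ℝ, 0 < s ∧ s < 1 ∧ r ≤ s * r' ∧
      ∀ k, 0 < avg (cellInd q k) → (Real.exp (2 * L) - 1) *
        avg (fun ξ => (1 - cellPoisson q k (s * ξ)) * cellInd q k ξ) ≤ t * avg (cellInd q k) := by
    have h1 : ∀ᶠ s : ℝ in 𝓝[<] 1, 0 < s := mem_nhdsWithin_of_mem_nhds (lt_mem_nhds zero_lt_one)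
    have h2 : ∀ᶠ s : ℝ in 𝓝[<] 1, s < 1 := self_mem_nhdsWithin
    have h3 : ∀ᶠ s : ℝ in 𝓝[<] 1, r < s * r' := by
      have : Tendsto (fun s : ℝ => s * r') (𝓝[<] 1) (𝓝 (1 * r')) :=
        (Continuous.tendsto (by fun_prop) 1).mono_left nhdsWithin_le_nhds
      exact this.eventually (lt_mem_nhds (by simpa using hrr'))
    have h4 : ∀ᶠ s : ℝ in 𝓝[<] 1, ∀ k, 0 < avg (cellInd q k) → (Real.exp (2 * L) - 1) *
        avg (fun ξ => (1 - cellPoisson q k (s * ξ)) * cellInd q k ξ) ≤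
          t * avg (cellInd q k) := by
      rw [eventually_all]
      intro k
      by_cases hk : 0 < avg (cellInd q k)
      · have h5 := (tendsto_avg_one_sub_cellPoisson hq k).const_mul (Real.exp (2 * L) - 1)
        rw [mul_zero] at h5
        filter_upwards [h5.eventually (gt_mem_nhds (mul_pos ht hk))] with s hs _ using hs.le
      · exact Eventually.of_forall fun s h => absurd h hk
    obtain ⟨s, ⟨⟨h5, h6⟩, h7⟩, h8⟩ := (((h1.and h2).and h3).and h4).exists
    exact ⟨s, h5, h6, h7.le, h8⟩
  -- The mesh error took θ/2 and the distance to the circle takes the other θ/2, so that f/ψ has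
  -- norm at most (1 - θ) + θ/2 + θ/2 = 1 at radius `ρ`.
  obtain ⟨ρ, hsρ, hρ1, hρ⟩ : ∃ ρ : ℝ, s < ρ ∧ ρ < 1 ∧
      c * ((1 - ρ ^ 2) / (4 * (1 / n))) ≤ θ / 2 := by
    have h1 : ∀ᶠ ρ : ℝ in 𝓝[<] 1, s < ρ := mem_nhdsWithin_of_mem_nhds (lt_mem_nhds hs1)
    have h2 : ∀ᶠ ρ : ℝ in 𝓝[<] 1, ρ < 1 := self_mem_nhdsWithin
    have h3 : Tendsto (fun ρ : ℝ => c * ((1 - ρ ^ 2) / (4 * (1 / n)))) (𝓝[<] 1)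
        (𝓝 (c * ((1 - 1 ^ 2) / (4 * (1 / n))))) :=
      (Continuous.tendsto (by fun_prop) 1).mono_left nhdsWithin_le_nhds
    obtain ⟨ρ, ⟨h5, h6⟩, h7⟩ := ((h1.and h2).and
      (h3.eventually (gt_mem_nhds
        (show c * ((1 - 1 ^ 2) / (4 * (1 / (n : ℝ)))) < θ / 2 by simpa using hθ)))).exists
    exact ⟨ρ, h5, h6, h7.le⟩
  have hρ0 : 0 < ρ := hs0.trans hsρ
  have hup' : ∀ m : κ → ι → ℝ, (∀ k j, a k j ≤ m k j) → ∀ z ∈ Metric.sphere (0 : ℂ) ρ,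
      N₀ (fun j => ‖f z j / outer q m z j‖) ≤ 1 := by
    intro m ham z hz
    have hzn : ‖z‖ = ρ := by simpa using hz
    have := latticeNorm_div_outer_le_of_lipschitz hq (z := z) (by simpa [hzn] using hρ1) h₀ hΛ0 hη
      hn' hΛ ha ham (A := 1 - θ) fun ξ hξ => haf _ ξ hξ rfl
    rw [hzn, ← hc, mul_add] at this
    linarith
  obtain ⟨g, hgd, hg1, hgD⟩ := exists_solution_cell_averages_le hq hN (f := f) hs0 hsρ htD
    fun h hh0 hh1 => exists_solution_weighted_average_le h₀ h₁ hN hmul hfac hC hcor hθ' hq hf1 hlow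
      ha0 ha1 hs0 hsρ hρ1 ht (by positivity) hL hup' hst hh0 hh1
  have hrρ : r ≤ ρ := by nlinarith
  refine ⟨g, fun j => (hgd j).mono (Metric.ball_subset_ball hrρ),
    fun z hz => hg1 z (Metric.ball_subset_ball hrρ hz), fun z hz c' => ?_⟩
  refine (sum_norm_le_of_cell_averages hn'.le hq hN hs0 hsρ hgd hD'0.le hgD hr' hrs hz c').trans ?_
  exact mul_le_mul_of_nonneg_right hn1 (hN.nonneg _)

end FiniteSolution

/-! ### Sequence lattices and duality. -/

namespace IsNormedLattice

variable {ρ : (ℤ → ℂ) → ℝ≥0∞}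

lemma map_zero (h : IsNormedLattice ρ) : ρ 0 = 0 := (h.eq_zero_iff 0).2 rfl

lemma congr_norm (h : IsNormedLattice ρ) {f g : ℤ → ℂ} (hfg : ∀ j, ‖f j‖ = ‖g j‖) : ρ f = ρ g :=
  le_antisymm (h.mono _ _ fun j => (hfg j).le) (h.mono _ _ fun j => (hfg j).ge)

lemma sum_le (h : IsNormedLattice ρ) {κ : Type*} (s : Finset κ) (x : κ → ℤ → ℂ) :
    ρ (∑ k ∈ s, x k) ≤ ∑ k ∈ s, ρ (x k) := by
  classical
  induction s using Finset.induction_on with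
  | empty => simp [h.map_zero]
  | insert a s ha ih =>
    rw [Finset.sum_insert ha, Finset.sum_insert ha]
    exact (h.add_le _ _).trans (by gcongr)

/-- A unit vector outside the lattice means that all its elements vanish at that coordinate; such
coordinates can be discarded. -/
lemma single_lt_top (h : IsNormedLattice ρ) {f : ℤ → ℂ} (hf : ρ f < ∞) {j : ℤ} (hj : f j ≠ 0) :
    ρ (Pi.single j 1) < ∞ := by
  refine lt_of_le_of_lt (h.mono ((f j)⁻¹ • f) _ fun i => ?_)
    (by rw [h.smul]; exact ENNReal.mul_lt_top enorm_lt_top hf)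
  by_cases hi : i = j
  · subst hi; simp [hj]
  · simpa [hi] using mul_nonneg (inv_nonneg.2 (norm_nonneg (f j))) (norm_nonneg (f i))

lemma lt_top_of_support_subset (h : IsNormedLattice ρ) {S : Finset ℤ}
    (hS : ∀ j ∈ S, ρ (Pi.single j 1) < ∞) {f : ℤ → ℂ} (hf : ∀ j, j ∉ S → f j = 0) : ρ f < ∞ := by
  have : f = ∑ j ∈ S, f j • Pi.single j 1 := by
    ext i
    rw [Finset.sum_apply]
    by_cases hi : i ∈ S
    · rw [Finset.sum_eq_single i]
      · simp
      · intro j _ hji; simp [Ne.symm hji]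
      · exact fun h => absurd hi h
    · rw [hf i hi, Finset.sum_eq_zero]
      intro j hj
      have : i ≠ j := fun h => hi (h ▸ hj)
      simp [this]
  rw [this]
  refine (h.sum_le _ _).trans_lt (ENNReal.sum_lt_top.2 fun j hj => ?_)
  rw [h.smul]
  exact ENNReal.mul_lt_top enorm_lt_top (hS j hj)

lemma tsum_le_dualNorm_mul (h : IsNormedLattice ρ) {f g : ℤ → ℂ} (hf : ρ f < ∞) :
    ∑' j, ‖f j * g j‖ₑ ≤ dualNorm ρ g * ρ f := by
  by_cases h0 : ρ f = 0
  · rw [(h.eq_zero_iff f).1 h0]; simp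
  have hpos : 0 < (ρ f).toReal := ENNReal.toReal_pos h0 hf.ne
  set c : ℂ := (((ρ f).toReal⁻¹ : ℝ) : ℂ) with hc
  have hcn : ‖c‖ₑ = (ρ f)⁻¹ := by
    rw [hc, ← ofReal_norm, Complex.norm_real, Real.norm_of_nonneg (by positivity),
      ENNReal.ofReal_inv_of_pos hpos, ENNReal.ofReal_toReal hf.ne]
  have h1 : ρ (c • f) ≤ 1 := by
    rw [h.smul, hcn, ENNReal.inv_mul_cancel h0 hf.ne]
  have h2 : ∑' j, ‖(c • f) j * g j‖ₑ ≤ dualNorm ρ g :=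
    le_iSup₂ (f := fun (f : ℤ → ℂ) (_ : ρ f ≤ 1) => ∑' j, ‖f j * g j‖ₑ) (c • f) h1
  have h3 : ∑' j, ‖(c • f) j * g j‖ₑ = (ρ f)⁻¹ * ∑' j, ‖f j * g j‖ₑ := by
    rw [← ENNReal.tsum_mul_left]
    congr 1
    ext j
    rw [Pi.smul_apply, smul_eq_mul, mul_assoc, enorm_mul, hcn]
  rw [h3, ENNReal.inv_mul_le_iff h0 hf.ne] at h2
  rwa [mul_comm]

end IsNormedLattice

/-- The restriction of `ρ` to the real sequences supported in `S`. -/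
noncomputable def restrictNorm (ρ : (ℤ → ℂ) → ℝ≥0∞) (S : Finset ℤ) (x : S → ℝ) : ℝ :=
  (ρ fun j => if h : j ∈ S then (x ⟨j, h⟩ : ℂ) else 0).toReal

/-! ### Restriction to finitely many coordinates. -/

section Restrict

variable {ρ : (ℤ → ℂ) → ℝ≥0∞} (hρ : IsNormedLattice ρ) {S : Finset ℤ}
  (hS : ∀ j ∈ S, ρ (Pi.single j 1) < ∞)
include hρ hS

lemma ofReal_restrictNorm (x : S → ℝ) {f : ℤ → ℂ} (hf : ∀ j (h : j ∈ S), ‖f j‖ = |x ⟨j, h⟩|)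
    (hf0 : ∀ j, j ∉ S → f j = 0) : ENNReal.ofReal (restrictNorm ρ S x) = ρ f := by
  have h1 : ρ (fun j => if h : j ∈ S then (x ⟨j, h⟩ : ℂ) else 0) < ∞ :=
    hρ.lt_top_of_support_subset hS fun j hj => dif_neg hj
  rw [restrictNorm, ENNReal.ofReal_toReal h1.ne]
  refine hρ.congr_norm fun j => ?_
  by_cases hj : j ∈ S
  · simp [hj, hf j hj]
  · simp [hj, hf0 j hj]

lemma restrictNorm_eq (x : S → ℝ) {f : ℤ → ℂ} (hf : ∀ j (h : j ∈ S), ‖f j‖ = |x ⟨j, h⟩|)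
    (hf0 : ∀ j, j ∉ S → f j = 0) : restrictNorm ρ S x = (ρ f).toReal := by
  rw [← ofReal_restrictNorm hρ hS x hf hf0, restrictNorm,
    ENNReal.toReal_ofReal ENNReal.toReal_nonneg]

lemma isLatticeNorm_restrictNorm : IsLatticeNorm (restrictNorm ρ S) := by
  have hfin : ∀ x : S → ℝ, ρ (fun j => if h : j ∈ S then (x ⟨j, h⟩ : ℂ) else 0) < ∞ := fun x =>
    hρ.lt_top_of_support_subset hS fun j hj => dif_neg hj
  refine ⟨fun x y => ?_, fun c x => ?_, fun x y hxy => ?_, fun x hx => ?_⟩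
  · rw [restrictNorm, restrictNorm, restrictNorm, ← ENNReal.toReal_add (hfin x).ne (hfin y).ne]
    refine ENNReal.toReal_mono (ENNReal.add_lt_top.2 ⟨hfin x, hfin y⟩).ne
      ((le_of_eq ?_).trans (hρ.add_le _ _))
    congr 1
    ext j
    by_cases hj : j ∈ S <;> simp [hj]
  · have h1 : |c| = ‖(c : ℂ)‖ₑ.toReal := by simp
    rw [restrictNorm, restrictNorm, h1, ← ENNReal.toReal_mul, ← hρ.smul]
    congr 2
    ext j
    by_cases hj : j ∈ S <;> simp [hj]
  · refine ENNReal.toReal_mono (hfin y).ne (hρ.mono _ _ fun j => ?_)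
    by_cases hj : j ∈ S
    · simpa [hj] using hxy ⟨j, hj⟩
    · simp [hj]
  · rw [restrictNorm, ENNReal.toReal_eq_zero_iff, or_iff_left (hfin x).ne, hρ.eq_zero_iff] at hx
    ext ⟨j, hj⟩
    simpa [hj] using congrFun hx j

lemma sum_mul_le_of_dualNorm_le {g : ℤ → ℂ} {C : ℝ≥0} (hg : dualNorm ρ g ≤ C) (x : S → ℝ) :
    ∑ j : S, |x j| * ‖g j‖ ≤ C * restrictNorm ρ S x := by
  set f : ℤ → ℂ := fun j => if h : j ∈ S then (x ⟨j, h⟩ : ℂ) else 0 with hf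
  have hfin : ρ f < ∞ := hρ.lt_top_of_support_subset hS fun j hj => dif_neg hj
  have h1 : ∑' j, ‖f j * g j‖ₑ ≤ C * ρ f :=
    (hρ.tsum_le_dualNorm_mul hfin).trans (by gcongr)
  have h2 : ∑ j : S, ‖f j * g j‖ₑ ≤ ∑' j, ‖f j * g j‖ₑ := by
    rw [Finset.sum_coe_sort S fun j => ‖f j * g j‖ₑ]
    exact ENNReal.sum_le_tsum S
  have h3 := ENNReal.toReal_mono (ENNReal.mul_lt_top ENNReal.coe_lt_top hfin).ne (h2.trans h1)
  rw [ENNReal.toReal_sum fun _ _ => enorm_ne_top, ENNReal.toReal_mul, ENNReal.coe_toReal] at h3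
  refine le_trans (le_of_eq (Finset.sum_congr rfl fun j _ => ?_)) h3
  simp [hf]

lemma dualNorm_le_of_sum_mul_le {g : ℤ → ℂ} (hg0 : ∀ j, j ∉ S → g j = 0) {D : ℝ} (hD : 0 ≤ D)
    (hg : ∀ x : S → ℝ, ∑ j : S, |x j| * ‖g j‖ ≤ D * restrictNorm ρ S x) :
    dualNorm ρ g ≤ ENNReal.ofReal D := by
  refine iSup₂_le fun f hf => ?_
  have h1 : ∑' j, ‖f j * g j‖ₑ = ∑ j ∈ S, ‖f j * g j‖ₑ :=
    tsum_eq_sum fun j hj => by simp [hg0 j hj]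
  rw [h1, ← Finset.sum_coe_sort S fun j => ‖f j * g j‖ₑ]
  have h2 := hg fun j => ‖f j‖
  have h3 : restrictNorm ρ S (fun j => ‖f j‖) ≤ 1 := by
    rw [restrictNorm_eq hρ hS _ (f := fun j => if j ∈ S then f j else 0)
      (fun j hj => by simp [hj]) fun j hj => if_neg hj]
    refine ENNReal.toReal_le_of_le_ofReal zero_le_one ?_
    rw [ENNReal.ofReal_one]
    refine (hρ.mono _ _ fun j => ?_).trans hf
    by_cases hj : j ∈ S <;> simp [hj]
  have h4 : ∑ j : S, ‖f j * g j‖ₑ = ENNReal.ofReal (∑ j : S, |‖f j‖| * ‖g j‖) := by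
    rw [ENNReal.ofReal_sum_of_nonneg fun _ _ => by positivity]
    refine Finset.sum_congr rfl fun j _ => ?_
    rw [abs_norm, ← norm_mul, ofReal_norm]
  rw [h4]
  exact ENNReal.ofReal_le_ofReal (h2.trans (mul_le_of_le_one_right hD h3))

/-- Extension by zero turns finite data into data for the whole lattice. The other coordinates of
the solution do not enter the sum. -/
lemma hasFiniteCorona_restrictNorm {C : ℝ → ℝ≥0} (hC : HasCoronaProperty ρ C) {δ : ℝ} (hδ : 0 < δ)
    (hδ1 : δ < 1) : HasFiniteCorona (restrictNorm ρ S) δ (C δ) := by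
  intro φ hφ hφb
  set Φ : ℂ → ℤ → ℂ := fun z j => if h : j ∈ S then φ z ⟨j, h⟩ else 0 with hΦ
  have hn : ∀ z, ENNReal.ofReal (restrictNorm ρ S fun j => ‖φ z j‖) = ρ (Φ z) := fun z =>
    ofReal_restrictNorm hρ hS _ (fun j hj => by simp [hΦ, hj]) fun j hj => dif_neg hj
  have hb : ∀ z ∈ Metric.ball (0 : ℂ) 1, ENNReal.ofReal δ ≤ ρ (Φ z) ∧ ρ (Φ z) ≤ 1 := by
    intro z hz
    rw [← hn]
    exact ⟨ENNReal.ofReal_le_ofReal (hφb z hz).1, ENNReal.ofReal_le_one.2 (hφb z hz).2⟩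
  obtain ⟨g, hg, hgC, hg1⟩ := hC δ hδ hδ1 Φ
    ⟨fun j => by
      by_cases hj : j ∈ S
      · simpa [hΦ, hj] using hφ ⟨j, hj⟩
      · simp [hΦ, hj],
      (iSup₂_le fun z hz => (hb z hz).2).trans_lt ENNReal.one_lt_top⟩ hb
  refine ⟨fun z j => g z j, fun j => hg.1 j, fun z hz => ?_, fun z hz x => ?_⟩
  · have h1 : HasSum (fun j => Φ z j * g z j) (∑ j ∈ S, Φ z j * g z j) :=
      hasSum_sum_of_ne_finset_zero fun j hj => by simp [hΦ, hj]
    refine Eq.trans ?_ ((hg1 z hz).unique h1).symm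
    rw [← Finset.sum_coe_sort S]
    exact Finset.sum_congr rfl fun j _ => by simp [hΦ]
  · exact sum_mul_le_of_dualNorm_le hρ hS
      ((le_iSup₂ (f := fun z (_ : z ∈ Metric.ball (0 : ℂ) 1) => dualNorm ρ (g z)) z hz).trans hgC) x

end Restrict

/-! ### Factorization in the restricted product lattice. -/

section Product

variable {ρ₀ ρ₁ : (ℤ → ℂ) → ℝ≥0∞}

lemma prodNorm_mul_le {x y : ℤ → ℂ} (hx : ρ₀ x < ∞) (hy : ρ₁ y < ∞) :
    prodNorm ρ₀ ρ₁ (x * y) ≤ ρ₀ x * ρ₁ y :=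
  iInf_le_of_le x <| iInf_le_of_le y <| iInf_le_of_le hx <| iInf_le_of_le hy <|
    iInf_le_of_le rfl le_rfl

lemma exists_mul_lt_of_prodNorm_lt {h : ℤ → ℂ} {b : ℝ≥0∞} (hb : prodNorm ρ₀ ρ₁ h < b) :
    ∃ x y, ρ₀ x < ∞ ∧ ρ₁ y < ∞ ∧ h = x * y ∧ ρ₀ x * ρ₁ y < b := by
  simp only [prodNorm, iInf_lt_iff] at hb
  obtain ⟨x, y, hx, hy, hxy, hlt⟩ := hb
  exact ⟨x, y, hx, hy, hxy, hlt⟩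

variable (h₀ : IsNormedLattice ρ₀) (h₁ : IsNormedLattice ρ₁)
include h₀ h₁

lemma single_lt_top_of_prodNorm {j : ℤ} (h : prodNorm ρ₀ ρ₁ (Pi.single j 1) < ∞) :
    ρ₀ (Pi.single j 1) < ∞ ∧ ρ₁ (Pi.single j 1) < ∞ := by
  obtain ⟨x, y, hx, hy, hxy, -⟩ := exists_mul_lt_of_prodNorm_lt h
  have := congrFun hxy j
  simp only [Pi.single_eq_same, Pi.mul_apply] at this
  exact ⟨h₀.single_lt_top hx fun h => by simp [h] at this,
    h₁.single_lt_top hy fun h => by simp [h] at this⟩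

variable {S : Finset ℤ} (hS : ∀ j ∈ S, prodNorm ρ₀ ρ₁ (Pi.single j 1) < ∞)
include hS

lemma restrictNorm_mul_le (x y : S → ℝ) :
    restrictNorm (prodNorm ρ₀ ρ₁) S (x * y) ≤ restrictNorm ρ₀ S x * restrictNorm ρ₁ S y := by
  have hx : ρ₀ (fun j => if h : j ∈ S then (x ⟨j, h⟩ : ℂ) else 0) < ∞ :=
    h₀.lt_top_of_support_subset (fun j hj => (single_lt_top_of_prodNorm h₀ h₁ (hS j hj)).1)
      fun j hj => dif_neg hj
  have hy : ρ₁ (fun j => if h : j ∈ S then (y ⟨j, h⟩ : ℂ) else 0) < ∞ :=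
    h₁.lt_top_of_support_subset (fun j hj => (single_lt_top_of_prodNorm h₀ h₁ (hS j hj)).2)
      fun j hj => dif_neg hj
  rw [restrictNorm, restrictNorm, restrictNorm, ← ENNReal.toReal_mul]
  refine ENNReal.toReal_mono (ENNReal.mul_lt_top hx hy).ne
    ((le_of_eq ?_).trans (prodNorm_mul_le hx hy))
  congr 1
  ext j
  by_cases hj : j ∈ S <;> simp [hj]

/-- A near-optimal factorization in the full product is restricted to `S` and made real by passing
to moduli. Only the product of the two norms is controlled, so the factors are finally rescaled to
the prescribed radii. -/
lemma hasFactorization_restrictNorm (hE : IsNormedLattice (prodNorm ρ₀ ρ₁)) :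
    HasFactorization (restrictNorm ρ₀ S) (restrictNorm ρ₁ S)
      (restrictNorm (prodNorm ρ₀ ρ₁) S) := by
  intro x A B hA hB hx
  have hS0 := fun j hj => (single_lt_top_of_prodNorm h₀ h₁ (hS j hj)).1
  have hS1 := fun j hj => (single_lt_top_of_prodNorm h₀ h₁ (hS j hj)).2
  have hN0 := isLatticeNorm_restrictNorm h₀ hS0
  have hN1 := isLatticeNorm_restrictNorm h₁ hS1
  obtain ⟨u, v, hu, hv, huv, hlt⟩ : ∃ u v, ρ₀ u < ∞ ∧ ρ₁ v < ∞ ∧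
      (fun j => if h : j ∈ S then (x ⟨j, h⟩ : ℂ) else 0) = u * v ∧
      ρ₀ u * ρ₁ v < ENNReal.ofReal (A * B) := by
    refine exists_mul_lt_of_prodNorm_lt ?_
    rw [← ofReal_restrictNorm hE hS x (fun j hj => by simp [hj]) fun j hj => dif_neg hj]
    exact (ENNReal.ofReal_lt_ofReal_iff (by positivity)).2 hx
  set y : S → ℝ := fun j => ‖u j‖ with hy
  -- The second factor carries the sign of x.
  set w : S → ℝ := fun j => SignType.sign (x j) * ‖v j‖ with hw
  have hxyw : x = y * w := by
    ext j
    have h1 : (x j : ℂ) = u j * v j := by simpa using congrFun huv j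
    have h2 : |x j| = ‖u j‖ * ‖v j‖ := by rw [← norm_mul, ← h1, Complex.norm_real, Real.norm_eq_abs]
    simp only [hy, hw, Pi.mul_apply]
    rw [mul_left_comm, ← h2, sign_mul_abs]
  have hya : restrictNorm ρ₀ S y ≤ (ρ₀ u).toReal := by
    rw [restrictNorm_eq h₀ hS0 _ (f := fun j => if j ∈ S then u j else 0)
      (fun j hj => by simp [hj, hy]) fun j hj => if_neg hj]
    refine ENNReal.toReal_mono hu.ne (h₀.mono _ _ fun j => ?_)
    by_cases hj : j ∈ S <;> simp [hj]
  have hwb : restrictNorm ρ₁ S w ≤ (ρ₁ v).toReal := by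
    refine ENNReal.toReal_mono hv.ne (h₁.mono _ _ fun j => ?_)
    by_cases hj : j ∈ S
    · simp only [hj, dif_pos, hw, Complex.norm_real, norm_mul, norm_norm]
      refine mul_le_of_le_one_left (norm_nonneg _) ?_
      rcases lt_trichotomy (x ⟨j, hj⟩) 0 with h | h | h <;> simp [h]
    · simp [hj]
  have hab : restrictNorm ρ₀ S y * restrictNorm ρ₁ S w < A * B := by
    calc _ ≤ (ρ₀ u).toReal * (ρ₁ v).toReal :=
          mul_le_mul hya hwb (hN1.nonneg _) ENNReal.toReal_nonneg
      _ < A * B := by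
          rw [← ENNReal.toReal_mul, ← ENNReal.toReal_ofReal (mul_pos hA hB).le]
          exact (ENNReal.toReal_lt_toReal (ENNReal.mul_lt_top hu hv).ne ENNReal.ofReal_ne_top).2 hlt
  rcases (hN0.nonneg y).eq_or_lt with h | hpos
  · have hy0 := hN0.eq_zero y h.symm
    refine ⟨0, 0, by rw [hxyw, hy0, zero_mul, zero_mul], ?_, ?_⟩
    · rw [hN0.map_zero]; exact hA.le
    · rw [hN1.map_zero]; exact hB.le
  · refine ⟨(A / restrictNorm ρ₀ S y) • y, (restrictNorm ρ₀ S y / A) • w, ?_, ?_, ?_⟩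
    · rw [hxyw, smul_mul_smul_comm, div_mul_div_comm, mul_comm A, div_self (by positivity),
        one_smul]
    · rw [hN0.smul_nonneg (by positivity), div_mul_cancel₀ _ hpos.ne']
    · rw [hN1.smul_nonneg (by positivity), div_mul_eq_mul_div, div_le_iff₀ hA, mul_comm B]
      exact hab.le

end Product

/-! ### Truncation and order continuity. -/

/-- The truncation of a sequence to `S`. -/
noncomputable def truncate (S : Finset ℤ) (f : ℤ → ℂ) (j : ℤ) : ℂ := if j ∈ S then f j else 0

section Truncation

variable {ρ : (ℤ → ℂ) → ℝ≥0∞}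

lemma restrictNorm_norm_eq (hρ : IsNormedLattice ρ) {S : Finset ℤ}
    (hS : ∀ j ∈ S, ρ (Pi.single j 1) < ∞) (f : ℤ → ℂ) :
    restrictNorm ρ S (fun j => ‖f j‖) = (ρ (truncate S f)).toReal :=
  restrictNorm_eq hρ hS _ (fun j hj => by simp [truncate, hj]) fun j hj => if_neg hj

lemma ofReal_restrictNorm_norm (hρ : IsNormedLattice ρ) {S : Finset ℤ}
    (hS : ∀ j ∈ S, ρ (Pi.single j 1) < ∞) (f : ℤ → ℂ) :
    ENNReal.ofReal (restrictNorm ρ S fun j => ‖f j‖) = ρ (truncate S f) :=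
  ofReal_restrictNorm hρ hS _ (fun j hj => by simp [truncate, hj]) fun j hj => if_neg hj

open Classical in
/-- The coordinates in `[-n, n]` that are not identically zero on the lattice. -/
noncomputable def window (ρ : (ℤ → ℂ) → ℝ≥0∞) (n : ℕ) : Finset ℤ :=
  (Finset.Icc (-n : ℤ) n).filter fun j => ρ (Pi.single j 1) < ∞

lemma single_lt_top_of_mem_window {n : ℕ} {j : ℤ} (hj : j ∈ window ρ n) :
    ρ (Pi.single j 1) < ∞ := by
  classical
  exact (Finset.mem_filter.1 hj).2

lemma window_mono : Monotone (window ρ) := by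
  classical
  intro n m hnm j hj
  simp only [window, Finset.mem_filter, Finset.mem_Icc] at hj ⊢
  exact ⟨⟨by omega, by omega⟩, hj.2⟩

lemma eventually_truncate_window_eq (hρ : IsNormedLattice ρ) {f : ℤ → ℂ} (hf : ρ f < ∞) (j : ℤ) :
    ∀ᶠ n in atTop, truncate (window ρ n) f j = f j := by
  filter_upwards [eventually_ge_atTop j.natAbs] with n hn
  by_cases hj : f j = 0
  · simp [truncate, hj]
  · have : j ∈ window ρ n := by
      classical
      simp only [window, Finset.mem_filter, Finset.mem_Icc]
      exact ⟨⟨by omega, by omega⟩, hρ.single_lt_top hf hj⟩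
    simp [truncate, this]

lemma norm_sub_truncate_le (S : Finset ℤ) (f : ℤ → ℂ) (j : ℤ) :
    ‖(f - truncate S f) j‖ ≤ ‖f j‖ := by
  by_cases hj : j ∈ S <;> simp [truncate, hj]

lemma tendsto_sub_truncate (hρ : IsNormedLattice ρ) (hoc : OrderContinuous ρ) {f : ℤ → ℂ}
    (hf : ρ f < ∞) : Tendsto (fun n => ρ (f - truncate (window ρ n) f)) atTop (𝓝 0) := by
  refine hoc _ f hf (fun n j => norm_sub_truncate_le _ _ _) fun j => ?_
  refine tendsto_const_nhds.congr' ?_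
  filter_upwards [eventually_truncate_window_eq hρ hf j] with n hn
  simp [hn]

lemma exists_lt_truncate (hρ : IsNormedLattice ρ) (hoc : OrderContinuous ρ) {f : ℤ → ℂ}
    (hf : ρ f < ∞) {c : ℝ≥0∞} (hc : c < ρ f) : ∃ n, c < ρ (truncate (window ρ n) f) := by
  have h1 := tendsto_sub_truncate hρ hoc hf
  obtain ⟨n, hn⟩ := (h1.eventually (gt_mem_nhds (tsub_pos_of_lt hc))).exists
  refine ⟨n, ?_⟩
  by_contra! hle
  have h2 : ρ f ≤ ρ (f - truncate (window ρ n) f) + ρ (truncate (window ρ n) f) := by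
    refine (le_of_eq ?_).trans (hρ.add_le _ _)
    rw [sub_add_cancel]
  have hcf : c ≠ ∞ := (hc.trans_le le_top).ne
  have h3 : ρ (f - truncate (window ρ n) f) + ρ (truncate (window ρ n) f) < (ρ f - c) + c :=
    ENNReal.add_lt_add_of_lt_of_le (ne_top_of_le_ne_top hcf hle) hn hle
  rw [tsub_add_cancel_of_le hc.le] at h3
  exact absurd h2 (not_le.2 h3)

/-- A Dini type argument: the norms of the truncations are large on compact subsets. -/
lemma exists_truncate_forall_lt (hρ : IsNormedLattice ρ) (hoc : OrderContinuous ρ)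
    {f : ℂ → ℤ → ℂ} (hf : ∀ j, DifferentiableOn ℂ (fun z => f z j) (Metric.ball 0 1))
    (hfin : ∀ z ∈ Metric.ball (0 : ℂ) 1, ρ (f z) < ∞) {c : ℝ}
    (hc : ∀ z ∈ Metric.ball (0 : ℂ) 1, ENNReal.ofReal c < ρ (f z)) {r : ℝ} (hr : r < 1) :
    ∃ n, ∀ z ∈ Metric.closedBall (0 : ℂ) r,
      c ≤ restrictNorm ρ (window ρ n) fun j => ‖f z j‖ := by
  have hS : ∀ n, ∀ j ∈ window ρ n, ρ (Pi.single j 1) < ∞ := fun n j hj =>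
    single_lt_top_of_mem_window hj
  set U : ℕ → Set ℂ := fun n =>
    Metric.ball 0 1 ∩ (fun z => restrictNorm ρ (window ρ n) fun j => ‖f z j‖) ⁻¹' Set.Ioi c with hU
  have hUo : ∀ n, IsOpen (U n) := fun n => by
    refine ContinuousOn.isOpen_inter_preimage ?_ Metric.isOpen_ball isOpen_Ioi
    refine (isLatticeNorm_restrictNorm hρ (hS n)).continuous.comp_continuousOn ?_
    exact continuousOn_pi.2 fun j => (hf j).continuousOn.norm
  have hsub : Metric.closedBall (0 : ℂ) r ⊆ ⋃ n, U n := by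
    intro z hz
    have hzb : z ∈ Metric.ball (0 : ℂ) 1 := Metric.closedBall_subset_ball hr hz
    obtain ⟨n, hn⟩ := exists_lt_truncate hρ hoc (hfin z hzb) (hc z hzb)
    rw [← ofReal_restrictNorm_norm hρ (hS n)] at hn
    refine Set.mem_iUnion.2 ⟨n, hzb, ?_⟩
    by_contra hle
    exact absurd hn (not_lt.2 (ENNReal.ofReal_le_ofReal (not_lt.1 hle)))
  have hmono : Monotone U := by
    intro n m hnm z hz
    have h1 : c < restrictNorm ρ (window ρ n) fun j => ‖f z j‖ := hz.2
    refine ⟨hz.1, h1.trans_le ?_⟩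
    beta_reduce
    rw [restrictNorm_norm_eq hρ (hS n), restrictNorm_norm_eq hρ (hS m)]
    refine ENNReal.toReal_mono (hρ.lt_top_of_support_subset (hS m) fun j hj => if_neg hj).ne
      (hρ.mono _ _ fun j => ?_)
    by_cases hj : j ∈ window ρ n
    · simp [truncate, hj, window_mono hnm hj]
    · simp [truncate, hj]
  obtain ⟨n, hn⟩ := (isCompact_closedBall (0 : ℂ) r).elim_directed_cover U hUo hsub
    (directed_of_isDirected_le hmono)
  exact ⟨n, fun z hz => (hn hz).2.le⟩

end Truncation

/-! ### Limits of bounded analytic functions and approximate solutions. -/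

/-- Pointwise limits of uniformly bounded analytic functions are analytic. -/
lemma differentiableOn_of_tendsto {α : Type*} {l : Filter α} [l.NeBot] {G : α → ℂ → ℂ} {g : ℂ → ℂ}
    {B : ℝ} (hG : ∀ r : ℝ, r < 1 → ∀ᶠ a in l, DifferentiableOn ℂ (G a) (Metric.ball 0 r) ∧
      ∀ z ∈ Metric.ball (0 : ℂ) r, ‖G a z‖ ≤ B)
    (hlim : ∀ z ∈ Metric.ball (0 : ℂ) 1, Tendsto (fun a => G a z) l (𝓝 (g z))) :
    DifferentiableOn ℂ g (Metric.ball 0 1) := by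
  intro z hz
  have hz1 : ‖z‖ < 1 := by simpa using hz
  obtain ⟨r, hzr, hr⟩ := exists_between hz1
  have hB : 0 ≤ B := by
    obtain ⟨a, -, ha⟩ := (hG r hr).exists
    exact (norm_nonneg _).trans (ha z (by simpa using hzr))
  set e := (r - ‖z‖) / 2 with he
  have he0 : 0 < e := by linarith
  have hsub : ∀ w ∈ Metric.ball z e, Metric.ball w e ⊆ Metric.ball (0 : ℂ) r := by
    intro w hw v hv
    have h1 : ‖w - z‖ < e := by simpa [dist_eq_norm] using hw
    have h2 : ‖v - w‖ < e := by simpa [dist_eq_norm] using hv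
    have h3 : ‖v‖ ≤ ‖v - w‖ + ‖w - z‖ + ‖z‖ := by
      calc ‖v‖ = ‖(v - w) + (w - z) + z‖ := by congr 1; ring
        _ ≤ _ := norm_add₃_le
    simp only [mem_ball_zero_iff]
    linarith
  have hself : ∀ w ∈ Metric.ball z e, w ∈ Metric.ball (0 : ℂ) r := fun w hw =>
    hsub w hw (Metric.mem_ball_self he0)
  -- The Schwarz lemma on balls of radius `e` gives a common Lipschitz constant, which upgrades
  -- pointwise to locally uniform convergence. The summand 1 keeps `K` positive.
  set K := (B + B + 1) / e with hK
  have hK0 : 0 < K := by positivity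
  have hlip : ∀ᶠ a in l, ∀ w ∈ Metric.ball z e, ∀ v ∈ Metric.ball w e,
      ‖G a v - G a w‖ ≤ K * ‖v - w‖ := by
    filter_upwards [hG r hr] with a ha w hw v hv
    have := Complex.dist_le_div_mul_dist_of_mapsTo_ball (f := G a) (c := w) (R₁ := e)
      (R₂ := B + B + 1) (ha.1.mono (hsub w hw)) (fun u hu => ?_) hv
    · simpa [dist_eq_norm] using this
    · have h1 := ha.2 u (hsub w hw hu)
      have h2 := ha.2 w (hself w hw)
      have h3 := norm_sub_le (G a u) (G a w)
      simp only [Metric.mem_closedBall, dist_eq_norm]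
      linarith
  have hunif : TendstoLocallyUniformlyOn G g l (Metric.ball z (e / 2)) := by
    rw [Metric.tendstoLocallyUniformlyOn_iff]
    intro ε hε w hw
    have hwe : w ∈ Metric.ball z e := Metric.ball_subset_ball (by linarith) hw
    refine ⟨Metric.ball w (min e (ε / (4 * K))), mem_nhdsWithin_of_mem_nhds
      (Metric.ball_mem_nhds _ (lt_min he0 (by positivity))), ?_⟩
    have hw1 : w ∈ Metric.ball (0 : ℂ) 1 := Metric.ball_subset_ball hr.le (hself w hwe)
    filter_upwards [hlip, (hlim w hw1).eventually (Metric.ball_mem_nhds _ (show 0 < ε / 4 by positivity))]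
      with a ha haw v hv
    have hve : v ∈ Metric.ball w e := Metric.ball_subset_ball (min_le_left _ _) hv
    have hv1 : v ∈ Metric.ball (0 : ℂ) 1 := Metric.ball_subset_ball hr.le (hsub w hwe hve)
    have hvw : K * ‖v - w‖ ≤ ε / 4 := by
      have h1 : ‖v - w‖ < ε / (4 * K) := by
        have := Metric.ball_subset_ball (min_le_right e (ε / (4 * K))) hv
        simpa [dist_eq_norm] using this
      calc K * ‖v - w‖ ≤ K * (ε / (4 * K)) := mul_le_mul_of_nonneg_left h1.le hK0.le
        _ = ε / 4 := by field_simp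
    have h2 : ‖g v - g w‖ ≤ K * ‖v - w‖ :=
      le_of_tendsto ((hlim v hv1).sub (hlim w hw1)).norm
        (hlip.mono fun a ha => ha w hwe v hve)
    have h3 := ha w hwe v hve
    have h4 : ‖G a w - g w‖ < ε / 4 := by simpa [dist_eq_norm] using haw
    rw [dist_eq_norm]
    have h5 : ‖g v - G a v‖ ≤ ‖g v - g w‖ + ‖G a w - g w‖ + ‖G a v - G a w‖ := by
      rw [← norm_neg (G a w - g w), ← norm_neg (G a v - G a w)]
      calc ‖g v - G a v‖ = ‖(g v - g w) + -(G a w - g w) + -(G a v - G a w)‖ := by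
            congr 1; ring
        _ ≤ _ := norm_add₃_le
    linarith
  have hdiff : ∀ᶠ a in l, DifferentiableOn ℂ (G a) (Metric.ball z (e / 2)) := by
    filter_upwards [hG r hr] with a ha
    exact ha.1.mono fun w hw => hself w (Metric.ball_subset_ball (by linarith) hw)
  exact ((hunif.differentiableOn hdiff Metric.isOpen_ball).differentiableAt
    (Metric.ball_mem_nhds z (by positivity))).differentiableWithinAt

/-- The corona property for the product lattice, up to small losses in the constant and in the
domain. -/
lemma exists_approximate_solution {ρ₀ ρ₁ : (ℤ → ℂ) → ℝ≥0∞} (h₀ : IsNormedLattice ρ₀)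
    (h₁ : IsNormedLattice ρ₁) (hE : IsNormedLattice (prodNorm ρ₀ ρ₁))
    (hoc : OrderContinuous (prodNorm ρ₀ ρ₁)) {C : ℝ → ℝ≥0} (hC : HasCoronaProperty ρ₀ C) {δ : ℝ}
    (hδ : 0 < δ) (hδ1 : δ < 1) {f : ℂ → ℤ → ℂ}
    (hf : ∀ j, DifferentiableOn ℂ (fun z => f z j) (Metric.ball 0 1))
    (hfb : ∀ z ∈ Metric.ball (0 : ℂ) 1,
      ENNReal.ofReal δ ≤ prodNorm ρ₀ ρ₁ (f z) ∧ prodNorm ρ₀ ρ₁ (f z) ≤ 1)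
    {D r : ℝ} (hD : C (δ / 2) < D) (hr0 : 0 < r) (hr : r < 1) :
    ∃ g : ℂ → ℤ → ℂ, (∀ j, DifferentiableOn ℂ (fun z => g z j) (Metric.ball 0 r)) ∧
      ∀ z ∈ Metric.ball (0 : ℂ) r, HasSum (fun j => f z j * g z j) 1 ∧
        dualNorm (prodNorm ρ₀ ρ₁) (g z) ≤ ENNReal.ofReal D ∧
        ∀ j, ¬ prodNorm ρ₀ ρ₁ (Pi.single j 1) < ∞ → g z j = 0 := by
  set ρ := prodNorm ρ₀ ρ₁ with hρ
  have hC0 : (0 : ℝ) ≤ C (δ / 2) := (C (δ / 2)).2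
  have hfin : ∀ z ∈ Metric.ball (0 : ℂ) 1, ρ (f z) < ∞ := fun z hz =>
    (hfb z hz).2.trans_lt ENNReal.one_lt_top
  obtain ⟨θ, hθ, hθ', hθD⟩ : ∃ θ : ℝ, 0 < θ ∧ θ < 1 / 6 ∧ C (δ / 2) / (1 - 6 * θ) < D := by
    have hlim : Tendsto (fun θ : ℝ => C (δ / 2) / (1 - 6 * θ)) (𝓝[>] 0)
        (𝓝 (C (δ / 2) / (1 - 6 * 0))) := by
      refine Tendsto.mono_left ?_ nhdsWithin_le_nhds
      exact tendsto_const_nhds.div (Continuous.tendsto (by fun_prop) 0) (by norm_num)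
    obtain ⟨θ, ⟨h1, h2⟩, h3⟩ := (((hlim.eventually (gt_mem_nhds (by simpa using hD))).and
      self_mem_nhdsWithin).and (mem_nhdsWithin_of_mem_nhds
        (gt_mem_nhds (show (0 : ℝ) < 1 / 6 by norm_num)))).exists
    exact ⟨θ, h2, h3, h1⟩
  -- Dilation by `t` makes f analytic past the closed disk. The finite theorem then loses another
  -- factor `t`, so undoing the dilation leaves the disk of radius t² = r.
  set t := √r with ht
  have ht0 : 0 < t := Real.sqrt_pos.2 hr0
  have htt : t * t = r := Real.mul_self_sqrt hr0.le
  have ht1 : t < 1 := by nlinarith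
  have htc : (t : ℂ) ≠ 0 := by exact_mod_cast ht0.ne'
  -- The level (δ/2)(2 - 3θ) is strictly below δ, which leaves room for truncation, and is exactly
  -- what the finite theorem with lower bound δ/2 requires.
  obtain ⟨n, hn⟩ := exists_truncate_forall_lt hE hoc hf hfin (c := δ / 2 * (2 - 3 * θ))
    (fun z hz => lt_of_lt_of_le ((ENNReal.ofReal_lt_ofReal_iff hδ).2 (by nlinarith)) (hfb z hz).1)
    ht1
  set S := window ρ n with hSd
  have hS : ∀ j ∈ S, ρ (Pi.single j 1) < ∞ := fun j hj => single_lt_top_of_mem_window hj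
  have hS0 := fun j hj => (single_lt_top_of_prodNorm h₀ h₁ (hS j hj)).1
  have hS1 := fun j hj => (single_lt_top_of_prodNorm h₀ h₁ (hS j hj)).2
  have hscale : ∀ z : ℂ, ‖(t : ℂ) * z‖ = t * ‖z‖ := fun z => by
    rw [norm_mul, Complex.norm_real, Real.norm_of_nonneg ht0.le]
  obtain ⟨g, hgd, hg1, hgD⟩ := exists_solution_of_hasFiniteCorona
    (isLatticeNorm_restrictNorm h₀ hS0) (isLatticeNorm_restrictNorm h₁ hS1)
    (isLatticeNorm_restrictNorm hE hS) (restrictNorm_mul_le h₀ h₁ hS)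
    (hasFactorization_restrictNorm h₀ h₁ hS hE) hC0
    (hasFiniteCorona_restrictNorm h₀ hS0 hC (half_pos hδ) (by linarith)) hθ hθ'
    (f := fun z j => f (t * z) j) (R := 1 / t) (one_lt_one_div ht0 ht1)
    (fun j => (hf j).comp (f := fun z : ℂ => (t : ℂ) * z) (by fun_prop) fun z hz => by
      have : ‖z‖ < 1 / t := by simpa using hz
      rw [mem_ball_zero_iff, hscale, mul_comm]
      rwa [lt_div_iff₀ ht0] at this)
    (fun z hz => by
      have hz1 : ‖z‖ = 1 := by simpa using hz
      have htz : (t : ℂ) * z ∈ Metric.ball (0 : ℂ) 1 := by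
        rw [mem_ball_zero_iff, hscale, hz1, mul_one]; exact ht1
      rw [restrictNorm_norm_eq hE hS]
      refine ENNReal.toReal_le_of_le_ofReal zero_le_one ?_
      rw [ENNReal.ofReal_one]
      refine (hE.mono _ _ fun j => ?_).trans (hfb _ htz).2
      by_cases hj : j ∈ S <;> simp [truncate, hj])
    (fun z hz => by
      have hz1 : ‖z‖ < 1 := by simpa using hz
      refine hn _ ?_
      rw [mem_closedBall_zero_iff, hscale]
      nlinarith)
    hθD ht0 ht1
  have hdiv : ∀ z ∈ Metric.ball (0 : ℂ) r, z / t ∈ Metric.ball (0 : ℂ) t := by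
    intro z hz
    have : ‖z‖ < r := by simpa using hz
    rw [mem_ball_zero_iff, norm_div, Complex.norm_real, Real.norm_of_nonneg ht0.le,
      div_lt_iff₀ ht0, htt]
    exact this
  refine ⟨fun z j => if h : j ∈ S then g (z / t) ⟨j, h⟩ else 0, fun j => ?_, fun z hz =>
    ⟨?_, ?_, fun j hj => dif_neg fun h => hj (hS j h)⟩⟩
  · by_cases hj : j ∈ S
    · simp only [hj, dif_pos]
      exact (hgd ⟨j, hj⟩).comp (f := fun z : ℂ => z / (t : ℂ)) (by fun_prop) hdiv
    · simp [hj]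
  · have h2 := hg1 _ (hdiv z hz)
    rw [mul_div_cancel₀ z htc] at h2
    have h3 : HasSum (fun j => f z j * if h : j ∈ S then g (z / t) ⟨j, h⟩ else 0)
        (∑ j ∈ S, f z j * if h : j ∈ S then g (z / t) ⟨j, h⟩ else 0) :=
      hasSum_sum_of_ne_finset_zero fun j hj => by simp [hj]
    rw [← Finset.sum_coe_sort S] at h3
    rw [← h2]
    simpa using h3
  · refine dualNorm_le_of_sum_mul_le hE hS (fun j hj => dif_neg hj) (hC0.trans hD.le) fun x => ?_
    simpa using hgD _ (hdiv z hz) x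

/-! ### Dual norms and pairings under pointwise limits. -/

section Limits

variable {ρ : (ℤ → ℂ) → ℝ≥0∞}

lemma enorm_apply_le_dualNorm_mul (hρ : IsNormedLattice ρ) {j : ℤ} (hj : ρ (Pi.single j 1) < ∞)
    (g : ℤ → ℂ) : ‖g j‖ₑ ≤ dualNorm ρ g * ρ (Pi.single j 1) := by
  refine le_trans ?_ (hρ.tsum_le_dualNorm_mul hj)
  simpa using ENNReal.le_tsum (f := fun i => ‖(Pi.single j 1 : ℤ → ℂ) i * g i‖ₑ) j

/-- The tail of the pairing is the pairing with the tail of f, so it is small uniformly over bounded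
sets of the dual. -/
lemma enorm_sub_sum_le_dualNorm_mul (hρ : IsNormedLattice ρ) {f g : ℤ → ℂ} (hf : ρ f < ∞) {s : ℂ}
    (hs : HasSum (fun j => f j * g j) s) (S : Finset ℤ) :
    ‖s - ∑ j ∈ S, f j * g j‖ₑ ≤ dualNorm ρ g * ρ (f - truncate S f) := by
  have h1 : HasSum (fun j => (f - truncate S f) j * g j) (s - ∑ j ∈ S, f j * g j) := by
    have h2 : HasSum (fun j => truncate S f j * g j) (∑ j ∈ S, truncate S f j * g j) :=
      hasSum_sum_of_ne_finset_zero fun j hj => by simp [truncate, hj]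
    have h3 : ∑ j ∈ S, truncate S f j * g j = ∑ j ∈ S, f j * g j :=
      Finset.sum_congr rfl fun j hj => by simp [truncate, hj]
    rw [h3] at h2
    simpa [sub_mul] using hs.sub h2
  have hfin : ρ (f - truncate S f) < ∞ := (hρ.mono _ _ (norm_sub_truncate_le S f)).trans_lt hf
  refine le_trans ?_ (hρ.tsum_le_dualNorm_mul hfin)
  rw [← h1.tsum_eq]
  exact enorm_tsum_le_tsum_enorm

variable {α : Type*} {l : Filter α} [l.NeBot] {G : α → ℤ → ℂ} {g : ℤ → ℂ}

/-- The dual norm is lower semicontinuous for pointwise convergence. -/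
lemma dualNorm_le_of_tendsto (hlim : ∀ j, Tendsto (fun a => G a j) l (𝓝 (g j))) {c : α → ℝ≥0∞}
    {b : ℝ≥0∞} (hc : Tendsto c l (𝓝 b)) (hG : ∀ᶠ a in l, dualNorm ρ (G a) ≤ c a) :
    dualNorm ρ g ≤ b := by
  refine iSup₂_le fun f hf => ?_
  rw [ENNReal.tsum_eq_iSup_sum]
  refine iSup_le fun F => ?_
  refine le_of_tendsto_of_tendsto (f := fun a => ∑ j ∈ F, ‖f j * G a j‖ₑ)
    (tendsto_finsetSum F fun j _ => (tendsto_const_nhds.mul (hlim j)).enorm) hc ?_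
  filter_upwards [hG] with a ha
  refine ((ENNReal.sum_le_tsum F).trans ?_).trans ha
  exact le_iSup₂ (f := fun (f : ℤ → ℂ) (_ : ρ f ≤ 1) => ∑' j, ‖f j * G a j‖ₑ) f hf

/-- The pairing with an element of a lattice with order continuous norm is continuous for bounded
pointwise convergence. -/
lemma hasSum_of_tendsto (hρ : IsNormedLattice ρ) (hoc : OrderContinuous ρ) {f : ℤ → ℂ}
    (hf : ρ f < ∞) (hlim : ∀ j, Tendsto (fun a => G a j) l (𝓝 (g j))) {D : ℝ≥0∞} (hD : D ≠ ∞)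
    {s : ℂ} (hG : ∀ᶠ a in l, HasSum (fun j => f j * G a j) s ∧ dualNorm ρ (G a) ≤ D) :
    HasSum (fun j => f j * g j) s := by
  have hg : dualNorm ρ g ≤ D :=
    dualNorm_le_of_tendsto hlim tendsto_const_nhds (hG.mono fun a ha => ha.2)
  have hsum : Summable fun j => f j * g j := by
    refine Summable.of_enorm (ne_top_of_le_ne_top ?_ (hρ.tsum_le_dualNorm_mul hf))
    exact ENNReal.mul_ne_top (ne_top_of_le_ne_top hD hg) hf.ne
  obtain ⟨t, ht⟩ := hsum
  -- Both sums are compared with the same finite partial sum; the tails are uniformly small by order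
  -- continuity.
  have hbound : ∀ n, ‖t - s‖ₑ ≤ D * ρ (f - truncate (window ρ n) f) +
      D * ρ (f - truncate (window ρ n) f) := by
    intro n
    have h1 : ‖t - ∑ j ∈ window ρ n, f j * g j‖ₑ ≤ D * ρ (f - truncate (window ρ n) f) :=
      (enorm_sub_sum_le_dualNorm_mul hρ hf ht _).trans (by gcongr)
    have h2 : ‖s - ∑ j ∈ window ρ n, f j * g j‖ₑ ≤ D * ρ (f - truncate (window ρ n) f) := by
      refine le_of_tendsto (tendsto_const_nhds.sub (tendsto_finsetSum _ fun j _ =>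
        tendsto_const_nhds.mul (hlim j))).enorm ?_
      filter_upwards [hG] with a ha
      exact (enorm_sub_sum_le_dualNorm_mul hρ hf ha.1 _).trans (by gcongr; exact ha.2)
    calc ‖t - s‖ₑ = ‖(t - ∑ j ∈ window ρ n, f j * g j) - (s - ∑ j ∈ window ρ n, f j * g j)‖ₑ := by
          rw [sub_sub_sub_cancel_right]
      _ ≤ _ := enorm_sub_le.trans (add_le_add h1 h2)
  have hzero : Tendsto (fun n => D * ρ (f - truncate (window ρ n) f) +
      D * ρ (f - truncate (window ρ n) f)) atTop (𝓝 0) := by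
    have := ENNReal.Tendsto.const_mul (tendsto_sub_truncate hρ hoc hf) (Or.inr hD)
    simpa using this.add this
  have hts : ‖t - s‖ₑ ≤ 0 := ge_of_tendsto' hzero hbound
  rw [nonpos_iff_eq_zero, enorm_eq_zero, sub_eq_zero] at hts
  exact hts ▸ ht

end Limits

/-- Solutions of the corona problem on smaller disks with constants tending to `D` have a limit
that solves it on the whole disk with the constant `D`. -/
lemma exists_solution_of_approximate {ρ : (ℤ → ℂ) → ℝ≥0∞} (hρ : IsNormedLattice ρ)
    (hoc : OrderContinuous ρ) {f : ℂ → ℤ → ℂ} (hf : ∀ z ∈ Metric.ball (0 : ℂ) 1, ρ (f z) < ∞)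
    {D : ℝ≥0}
    (hsol : ∀ D' r : ℝ, D < D' → 0 < r → r < 1 →
      ∃ g : ℂ → ℤ → ℂ, (∀ j, DifferentiableOn ℂ (fun z => g z j) (Metric.ball 0 r)) ∧
        ∀ z ∈ Metric.ball (0 : ℂ) r, HasSum (fun j => f z j * g z j) 1 ∧
          dualNorm ρ (g z) ≤ ENNReal.ofReal D' ∧
          ∀ j, ¬ ρ (Pi.single j 1) < ∞ → g z j = 0) :
    ∃ g : ℂ → ℤ → ℂ, (∀ j, DifferentiableOn ℂ (fun z => g z j) (Metric.ball 0 1)) ∧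
      ∀ z ∈ Metric.ball (0 : ℂ) 1, HasSum (fun j => f z j * g z j) 1 ∧ dualNorm ρ (g z) ≤ D := by
  set e : ℕ → ℝ := fun n => 1 / ((n : ℝ) + 1) with he
  have he0 : ∀ n, 0 < e n := fun n => Nat.one_div_pos_of_nat
  have he1 : ∀ n, e n ≤ 1 := fun n => by
    rw [he, div_le_one (by positivity)]
    linarith [(Nat.cast_nonneg n : (0 : ℝ) ≤ n)]
  have helim : Tendsto e atTop (𝓝 0) := tendsto_one_div_add_atTop_nhds_zero_nat
  choose G hGd hG using fun n => hsol (D + e n) (1 - e n / 2) (by linarith [he0 n])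
    (by linarith [he1 n]) (by linarith [he0 n])
  -- An ultrafilter gives limits at all points and coordinates at once, in place of diagonal
  -- subsequences.
  set l : Ultrafilter ℕ := Ultrafilter.of atTop with hl
  have hlt : (l : Filter ℕ) ≤ atTop := Ultrafilter.of_le atTop
  have hball : ∀ r : ℝ, r < 1 → ∀ᶠ n in (l : Filter ℕ),
      Metric.ball (0 : ℂ) r ⊆ Metric.ball 0 (1 - e n / 2) := by
    intro r hr
    filter_upwards [(helim.mono_left hlt).eventually (gt_mem_nhds (sub_pos.2 hr))] with n hn
    exact Metric.ball_subset_ball (by linarith [he0 n])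
  have hmem : ∀ z ∈ Metric.ball (0 : ℂ) 1, ∀ᶠ n in (l : Filter ℕ),
      z ∈ Metric.ball (0 : ℂ) (1 - e n / 2) := by
    intro z hz
    obtain ⟨r, hzr, hr⟩ := exists_between (show ‖z‖ < 1 by simpa using hz)
    filter_upwards [hball r hr] with n hn
    exact hn (by simpa using hzr)
  have hdual : ∀ n, ∀ z ∈ Metric.ball (0 : ℂ) (1 - e n / 2),
      dualNorm ρ (G n z) ≤ ENNReal.ofReal (D + 1) := fun n z hz =>
    (hG n z hz).2.1.trans (ENNReal.ofReal_le_ofReal (by linarith [he1 n]))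
  -- If the unit vector is not in the lattice, the dual norm gives no control of that coordinate.
  -- There `B j` is 0 by the convention for `toReal`, and the approximate solutions vanish by
  -- assumption.
  set B : ℤ → ℝ := fun j => (ENNReal.ofReal (D + 1) * ρ (Pi.single j 1)).toReal with hB
  have hbound : ∀ n, ∀ z ∈ Metric.ball (0 : ℂ) (1 - e n / 2), ∀ j, ‖G n z j‖ ≤ B j := by
    intro n z hz j
    by_cases hj : ρ (Pi.single j 1) < ∞
    · have h1 : ‖G n z j‖ₑ ≤ ENNReal.ofReal (D + 1) * ρ (Pi.single j 1) :=
        (enorm_apply_le_dualNorm_mul hρ hj _).trans (by gcongr; exact hdual n z hz)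
      have h2 := ENNReal.toReal_mono (ENNReal.mul_lt_top ENNReal.ofReal_lt_top hj).ne h1
      rwa [toReal_enorm] at h2
    · rw [(hG n z hz).2.2 j hj, norm_zero]
      exact ENNReal.toReal_nonneg
  have hex : ∀ z : ℂ, ∀ j, ∃ w : ℂ, z ∈ Metric.ball (0 : ℂ) 1 →
      Tendsto (fun n => G n z j) l (𝓝 w) := by
    intro z j
    by_cases hz : z ∈ Metric.ball (0 : ℂ) 1
    · obtain ⟨w, -, hw⟩ := (isCompact_closedBall (0 : ℂ) (B j)).ultrafilter_le_nhds
        (l.map fun n => G n z j) (by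
          rw [le_principal_iff, Ultrafilter.coe_map, mem_map]
          filter_upwards [hmem z hz] with n hn
          simpa using hbound n z hn j)
      exact ⟨w, fun _ => hw⟩
    · exact ⟨0, fun h => absurd h hz⟩
  choose g hg using hex
  refine ⟨g, fun j => ?_, fun z hz => ⟨?_, ?_⟩⟩
  · refine differentiableOn_of_tendsto (l := (l : Filter ℕ)) (G := fun n z => G n z j) (B := B j)
      (fun r hr => ?_) fun z hz => hg z j hz
    filter_upwards [hball r hr] with n hn
    exact ⟨(hGd n j).mono hn, fun z hz => hbound n z (hn hz) j⟩
  · refine hasSum_of_tendsto (l := (l : Filter ℕ)) hρ hoc (hf z hz) (fun j => hg z j hz)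
      (D := ENNReal.ofReal (D + 1)) ENNReal.ofReal_ne_top ?_
    filter_upwards [hmem z hz] with n hn
    exact ⟨(hG n z hn).1, hdual n z hn⟩
  · refine dualNorm_le_of_tendsto (l := (l : Filter ℕ)) (fun j => hg z j hz)
      (c := fun n => ENNReal.ofReal (D + e n)) ?_ ((hmem z hz).mono fun n hn => (hG n z hn).2.1)
    have := ENNReal.tendsto_ofReal ((helim.mono_left hlt).const_add (D : ℝ))
    simpa using this

end SeqLattice

theorem theorem1 (ρ₀ ρ₁ : (ℤ → ℂ) → ℝ≥0∞)
    (h₀ : SeqLattice.IsBanachLattice ρ₀) (h₁ : SeqLattice.IsBanachLattice ρ₁)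
    (hE : SeqLattice.IsBanachLattice (SeqLattice.prodNorm ρ₀ ρ₁))
    (hoc : SeqLattice.OrderContinuous (SeqLattice.prodNorm ρ₀ ρ₁))
    (C : ℝ → ℝ≥0) (hC : SeqLattice.HasCoronaProperty ρ₀ C) :
    SeqLattice.HasCoronaProperty (SeqLattice.prodNorm ρ₀ ρ₁) (fun δ => C (δ / 2)) := by
  intro δ hδ hδ1 f hf hfb
  obtain ⟨g, hgd, hg⟩ := SeqLattice.exists_solution_of_approximate hE.toIsNormedLattice hoc
    (fun z hz => (hfb z hz).2.trans_lt ENNReal.one_lt_top) fun D r hD hr0 hr =>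
      SeqLattice.exists_approximate_solution h₀.toIsNormedLattice h₁.toIsNormedLattice
        hE.toIsNormedLattice hoc hC hδ hδ1 hf.1 hfb hD hr0 hr
  have hle : SeqLattice.hInftyNorm (SeqLattice.dualNorm (SeqLattice.prodNorm ρ₀ ρ₁)) g ≤
      C (δ / 2) := iSup₂_le fun z hz => (hg z hz).2
  exact ⟨g, ⟨hgd, hle.trans_lt ENNReal.coe_lt_top⟩, hle, fun z hz => (hg z hz).1⟩
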